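/- A degree-two sum-of-squares (SOS) refutation of a system of real polynomial equations $f_j(\boldsymbol{x})=0$ is an identity $\sum_j g_j f_j=\sum_\ell h_\ell^2+\epsilon$ with a constant $\epsilon>0$ and real polynomials $g_j,h_\ell$, in which every $g_jf_j$ and every $h_\ell^2$ has degree at most $2$. For a graph $G$ with vertex set $V$, adjacency matrix $A$ and $m$ edges, and for real variables $x_{i,c}$ ($i\in V$, $1\le c\le k$), consider the equations $$\text{(a)}\ x_{i,c}^2-x_{i,c}=0\ \ (i\in V,\ 1\le c\le k),\qquad \text{(b)}\ -1+\sum_c x_{i,c}=0\ \ (i\in V),$$ $$\text{(c)}\ -\frac{\tau}{k}+\frac{1}{2m}\sum_{i,j}A_{ij}\sum_c x_{i,c}x_{j,c}=0,\qquad \text{(d)}\ \sum_c x_{i,c}x_{j,c}=0\ \ (ij\in E(G)).$$ The system (a), (b), (c) encodes the existence of a good partition of $G$, that is, a partition into $k$ groups such that a fraction $\tau/k$ of the edges lie within groups; the system (a), (b), (d) encodes the $k$-colorability of $G$. Let $d\ge 2$ and $k\ge 1$ be fixed integers, and let $G_{n,d}$ be a uniformly random $d$-regular simple graph on $n$ labelled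 vertices. "With high probability" means with probability tending to $1$ as $n\to\infty$ through the integers with $nd$ even. **Theorem 2.** Fix a real $\tau<1$. If $$\frac{k-\tau}{1-\tau}>2+\frac{d}{2\sqrt{d-1}},$$ then with high probability there is no degree-two SOS refutation of the existence of a good partition of $G_{n,d}$, that is, of the system (a), (b), (c). Likewise, if $k>2+\frac{d}{2\sqrt{d-1}}$, then with high probability there is no degree-two SOS refutation of the $k$-colorability of $G_{n,d}$, that is, of the system (a), (b), (d). -/

import Mathlib

open Filter Topology

noncomputable section

/-- A degree-`δ` sum-of-squares refutation of the system `f = 0`, `f ∈ F`: an identity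
`∑ g_f f = ∑ h_l ^ 2 + ε` with `ε > 0` in which finitely many constraints `f ∈ F` are used and
every term `g_f f` and every square `h_l ^ 2` has degree at most `δ`. -/
def HasSOSRefutation {σ : Type*} (δ : ℕ) (F : Set (MvPolynomial σ ℝ)) : Prop :=
  ∃ (s : Finset (MvPolynomial σ ℝ)) (g : MvPolynomial σ ℝ → MvPolynomial σ ℝ)
    (t : ℕ) (h : Fin t → MvPolynomial σ ℝ) (ε : ℝ),
    (∀ f ∈ s, f ∈ F) ∧
    (∀ f ∈ s, (g f * f).totalDegree ≤ δ) ∧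
    (∀ l, (h l ^ 2).totalDegree ≤ δ) ∧
    0 < ε ∧
    ∑ f ∈ s, g f * f = ∑ l, h l ^ 2 + MvPolynomial.C ε

/-- The constraint `x² - x = 0`, where `x = x_{i,c}` indicates that vertex `i` has label `c`. -/
def boolPoly {V : Type*} {k : ℕ} (i : V) (c : Fin k) : MvPolynomial (V × Fin k) ℝ :=
  MvPolynomial.X (i, c) ^ 2 - MvPolynomial.X (i, c)

/-- The constraint that vertex `i` has exactly one label. -/
def singPoly {V : Type*} (k : ℕ) (i : V) : MvPolynomial (V × Fin k) ℝ :=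
  -1 + ∑ c : Fin k, MvPolynomial.X (i, c)

/-- The polynomial `∑_c x_{i,c} x_{j,c}`: the indicator that `i` and `j` have the same label. -/
def samePoly {V : Type*} (k : ℕ) (i j : V) : MvPolynomial (V × Fin k) ℝ :=
  ∑ c : Fin k, MvPolynomial.X (i, c) * MvPolynomial.X (j, c)

open Classical in
/-- The constraint that a fraction `τ / k` of the edges lie within groups, namely
`-τ/k + (1/(2m)) ∑_{i,j} A_{ij} ∑_c x_{i,c} x_{j,c} = 0`, where `A` is the adjacency matrix
and `m` the number of edges. -/
def cutPoly {V : Type*} [Fintype V] (G : SimpleGraph V) (k : ℕ) (τ : ℝ) :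
    MvPolynomial (V × Fin k) ℝ :=
  -MvPolynomial.C (τ / k) +
    MvPolynomial.C (1 / (2 * (G.edgeSet.ncard : ℝ))) *
      ∑ i : V, ∑ j : V, MvPolynomial.C (G.adjMatrix ℝ i j) * samePoly k i j

/-- The polynomial system expressing that labels in `Fin k` are assigned to the vertices. -/
def labelSystem (V : Type*) (k : ℕ) : Set (MvPolynomial (V × Fin k) ℝ) :=
  {p | ∃ (i : V) (c : Fin k), p = boolPoly i c} ∪ {p | ∃ i : V, p = singPoly k i}

/-- The polynomial system encoding the `k`-colorability of `G`. -/
def coloringSystem {V : Type*} (G : SimpleGraph V) (k : ℕ) :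
    Set (MvPolynomial (V × Fin k) ℝ) :=
  labelSystem V k ∪ {p | ∃ i j : V, G.Adj i j ∧ p = samePoly k i j}

/-- The polynomial system encoding the existence of a good partition of `G`: a partition into
`k` groups for which a fraction `τ / k` of the edges lie within groups. -/
def goodPartitionSystem {V : Type*} [Fintype V] (G : SimpleGraph V) (k : ℕ) (τ : ℝ) :
    Set (MvPolynomial (V × Fin k) ℝ) :=
  labelSystem V k ∪ {cutPoly G k τ}

open Classical in
/-- The set of `d`-regular simple graphs on the labelled vertices `0, …, n - 1`. -/
def regularGraphs (n d : ℕ) : Set (SimpleGraph (Fin n)) :=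
  {G | G.IsRegularOfDegree d}

/-- The probability that a uniformly random `d`-regular graph `G_{n,d}` has property `P`. -/
def regularProb (n d : ℕ) (P : SimpleGraph (Fin n) → Prop) : ℝ :=
  ({G ∈ regularGraphs n d | P G}.ncard : ℝ) / ((regularGraphs n d).ncard : ℝ)

/-- `G_{n,d}` has property `P` with high probability: the probability tends to `1` as `n → ∞`
along the `n` for which `n d` is even (for other `n` there is no `d`-regular graph). -/
def RegularWHP (d : ℕ) (P : ∀ n : ℕ, SimpleGraph (Fin n) → Prop) : Prop :=
  Tendsto (fun n : ℕ => regularProb n d (P n)) (atTop ⊓ 𝓟 {n : ℕ | Even (n * d)}) (𝓝 1)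

end

/-! A linear functional that fixes constants, is nonnegative on squares of degree at most two and
kills the admissible multiples of the constraints is incompatible with a refutation
(`not_hasSOSRefutation_of_pseudoExp`). Such a functional comes from a positive semidefinite matrix
`P` with unit diagonal: labels are uniform, and those of `i` and `j` agree with pseudoprobability (1
+ (k - 1) P i j) / k. The remaining constraints hold if P i j = -1/(κ - 1) on every edge, where κ =
(k - τ)/(1 - τ) for partitions and κ = k for colourings. So it suffices to find such a matrix, a
vector κ-colouring.

On the d-regular tree, let vertex i have the coordinates x ^ dist(i, w) with x = -1/√(d - 1),
truncated at distance L. As L grows, the correlation along edges tends to -2√(d - 1)/d, which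
corresponds to κ = 1 + d/(2√(d - 1)).

A random regular graph may contain short cycles, but with high probability no vertex set of bounded
size spans more edges than vertices (`card_not_nearlySparse_le`, by switchings and a union bound).
Then some independent set S meets every small set that spans a cycle
(`SimpleGraph.NearlySparse.exists_independent`). Deleting the edges at S leaves a graph that is
locally a forest, where the tree Gram matrix has its ideal entries (`treeGram_self`,
`treeGram_of_adj`). All vertices of S receive one common new unit vector; this costs one more colour
and turns the 1 into the 2 of the threshold (`SimpleGraph.exists_vectorColoring_of_isolate`). -/

noncomputable section

/-! ### Degree-two pseudoexpectations from a mean and a covariance. -/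

section PseudoExpectation

open MvPolynomial

variable {σ : Type*}

lemma MvPolynomial.pderiv_pderiv_eq_zero_of_totalDegree_le_one {p : MvPolynomial σ ℝ}
    (hp : p.totalDegree ≤ 1) (a b : σ) : pderiv a (pderiv b p) = 0 := by
  ext m
  rw [coeff_pderiv, coeff_pderiv, coeff_eq_zero_of_totalDegree_lt]
  · simp
  · refine lt_of_le_of_lt hp ?_
    have : (m + Finsupp.single a 1 + Finsupp.single b 1).degree = m.degree + 1 + 1 := by
      rw [map_add, map_add, Finsupp.degree_single, Finsupp.degree_single]
    rw [Finsupp.degree_apply] at this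
    change 1 < ∑ i ∈ _, _
    omega

lemma MvPolynomial.totalDegree_le_one_of_sq {p : MvPolynomial σ ℝ}
    (hp : (p ^ 2).totalDegree ≤ 2) : p.totalDegree ≤ 1 := by
  by_cases h0 : p = 0
  · simp [h0]
  · rw [sq, totalDegree_mul_of_isDomain h0 h0] at hp
    omega

variable [Fintype σ]

/-- The expectation of a polynomial of degree at most two in variables with mean `μ` and
covariance `C`. -/
def pseudoExp (μ : σ → ℝ) (C : σ → σ → ℝ) : MvPolynomial σ ℝ →ₗ[ℝ] ℝ where
  -- In degree two the Taylor expansion at `μ` is exact: the linear term averages to zero and the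
  -- quadratic term is half the Hessian paired with `C`.
  toFun p := eval μ p + (∑ a, ∑ b, C a b * eval μ (pderiv a (pderiv b p))) / 2
  map_add' p q := by
    simp only [map_add, mul_add, Finset.sum_add_distrib]
    ring
  map_smul' r p := by
    simp only [Derivation.map_smul, smul_eval, RingHom.id_apply, smul_eq_mul]
    rw [mul_add, ← mul_div_assoc, Finset.mul_sum]
    simp only [Finset.mul_sum]
    congr 2
    refine Finset.sum_congr rfl fun a _ => Finset.sum_congr rfl fun b _ => ?_
    ring

variable {μ : σ → ℝ} {C : σ → σ → ℝ}

lemma pseudoExp_apply (p : MvPolynomial σ ℝ) : pseudoExp μ C p =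
    eval μ p + (∑ a, ∑ b, C a b * eval μ (pderiv a (pderiv b p))) / 2 := rfl

lemma pseudoExp_C (r : ℝ) : pseudoExp μ C (MvPolynomial.C r) = r := by
  simp [pseudoExp_apply]

lemma pseudoExp_C_mul (r : ℝ) (p : MvPolynomial σ ℝ) :
    pseudoExp μ C (MvPolynomial.C r * p) = r * pseudoExp μ C p := by
  rw [← smul_eq_C_mul, map_smul, smul_eq_mul]

lemma pseudoExp_X (a : σ) : pseudoExp μ C (X a) = μ a := by
  have h (i j : σ) : pderiv i (pderiv j (X a : MvPolynomial σ ℝ)) = 0 :=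
    pderiv_pderiv_eq_zero_of_totalDegree_le_one (by simp) _ _
  simp [pseudoExp_apply, h]

lemma pseudoExp_mul (hC : ∀ a b, C a b = C b a) {p q : MvPolynomial σ ℝ}
    (hp : p.totalDegree ≤ 1) (hq : q.totalDegree ≤ 1) :
    pseudoExp μ C (p * q) = eval μ p * eval μ q +
      ∑ a, ∑ b, C a b * (eval μ (pderiv a p) * eval μ (pderiv b q)) := by
  have h (a b : σ) : eval μ (pderiv a (pderiv b (p * q))) =
      eval μ (pderiv a p) * eval μ (pderiv b q) + eval μ (pderiv b p) * eval μ (pderiv a q) := by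
    simp only [pderiv_mul, map_add, pderiv_pderiv_eq_zero_of_totalDegree_le_one hp,
      pderiv_pderiv_eq_zero_of_totalDegree_le_one hq, map_mul]
    simp
    ring
  have h2 : ∑ a, ∑ b, C a b * (eval μ (pderiv b p) * eval μ (pderiv a q)) =
      ∑ a, ∑ b, C a b * (eval μ (pderiv a p) * eval μ (pderiv b q)) := by
    rw [Finset.sum_comm]
    simp only [hC]
  simp only [pseudoExp_apply, h, mul_add, Finset.sum_add_distrib, h2, map_mul]
  ring

lemma pseudoExp_X_mul_X (hC : ∀ a b, C a b = C b a) (i j : σ) :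
    pseudoExp μ C (X i * X j) = μ i * μ j + C i j := by
  classical
  rw [pseudoExp_mul hC (by simp) (by simp)]
  simp [pderiv_X, Pi.single_apply, Finset.sum_ite_eq, apply_ite]

/-- A square of degree at most two is the square of an affine function, so its value is mean squared
plus variance. -/
lemma pseudoExp_sq_nonneg (hC : ∀ a b, C a b = C b a)
    (hpsd : ∀ y : σ → ℝ, 0 ≤ ∑ a, ∑ b, C a b * (y a * y b)) {p : MvPolynomial σ ℝ}
    (hp : (p ^ 2).totalDegree ≤ 2) : 0 ≤ pseudoExp μ C (p ^ 2) := by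
  have h1 := totalDegree_le_one_of_sq hp
  rw [sq, pseudoExp_mul hC h1 h1]
  exact add_nonneg (mul_self_nonneg _) (hpsd _)

/-- A pseudoexpectation that annihilates every degree-two multiple of the constraints precludes
a degree-two refutation. -/
lemma not_hasSOSRefutation_of_pseudoExp (hC : ∀ a b, C a b = C b a)
    (hpsd : ∀ y : σ → ℝ, 0 ≤ ∑ a, ∑ b, C a b * (y a * y b)) {F : Set (MvPolynomial σ ℝ)}
    (hF : ∀ f ∈ F, ∀ g : MvPolynomial σ ℝ, (g * f).totalDegree ≤ 2 →
      pseudoExp μ C (g * f) = 0) : ¬ HasSOSRefutation 2 F := by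
  rintro ⟨s, g, t, h, ε, hs, hg, hh, hε, heq⟩
  have h1 := congrArg (pseudoExp μ C) heq
  rw [map_sum, Finset.sum_eq_zero fun f hf => hF f (hs f hf) _ (hg f hf), map_add, map_sum,
    pseudoExp_C] at h1
  have h2 : 0 ≤ ∑ l, pseudoExp μ C (h l ^ 2) :=
    Finset.sum_nonneg fun l _ => pseudoExp_sq_nonneg hC hpsd (hh l)
  linarith

/-- For a constraint of degree two, only constant multiples matter. -/
lemma pseudoExp_mul_eq_zero_of_quadratic {f g : MvPolynomial σ ℝ} {a b : σ}
    (hab : pderiv a (pderiv b f) ≠ 0) (hf : pseudoExp μ C f = 0)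
    (hg : (g * f).totalDegree ≤ 2) : pseudoExp μ C (g * f) = 0 := by
  by_cases hg0 : g = 0
  · simp [hg0]
  have hf0 : f ≠ 0 := by rintro rfl; simp at hab
  have hf2 : 1 < f.totalDegree := by
    by_contra! hle
    exact hab (pderiv_pderiv_eq_zero_of_totalDegree_le_one hle _ _)
  rw [totalDegree_mul_of_isDomain hg0 hf0] at hg
  rw [totalDegree_eq_zero_iff_eq_C.mp (show g.totalDegree = 0 by omega), pseudoExp_C_mul, hf,
    mul_zero]

/-- An affine constraint that vanishes at the mean and whose gradient is in the kernel of the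
covariance is annihilated together with its multiples. -/
lemma pseudoExp_mul_eq_zero_of_affine (hC : ∀ a b, C a b = C b a) {f g : MvPolynomial σ ℝ}
    (hf0 : f ≠ 0) (hf1 : f.totalDegree = 1) (hf : eval μ f = 0)
    (hgrad : ∀ a, ∑ b, C a b * eval μ (pderiv b f) = 0)
    (hg : (g * f).totalDegree ≤ 2) : pseudoExp μ C (g * f) = 0 := by
  by_cases hg0 : g = 0
  · simp [hg0]
  rw [totalDegree_mul_of_isDomain hg0 hf0] at hg
  rw [pseudoExp_mul hC (by omega) hf1.le, hf, mul_zero, zero_add]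
  refine Finset.sum_eq_zero fun a _ => ?_
  rw [← mul_zero (eval μ (pderiv a g)), ← hgrad a, Finset.mul_sum]
  exact Finset.sum_congr rfl fun b _ => by ring

end PseudoExpectation

/-! ### Pseudoexpectations on labellings built from a correlation matrix. -/

section Labellings

open MvPolynomial

variable {V : Type*} {k : ℕ}

/-- The covariance of the labels of vertices `i` and `j` when the labels are uniform and agree with
probability `(1 + (k - 1) P i j) / k`. -/
def labelCov (k : ℕ) (P : V → V → ℝ) (a b : V × Fin k) : ℝ :=
  P a.1 b.1 * ((if a.2 = b.2 then (k : ℝ) else 0) - 1) / (k : ℝ) ^ 2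

/-- The pseudoexpectation on `k`-labellings with uniform labels and correlations `P`. -/
abbrev labelExp [Fintype V] (k : ℕ) (P : V → V → ℝ) : MvPolynomial (V × Fin k) ℝ →ₗ[ℝ] ℝ :=
  pseudoExp (fun _ => 1 / (k : ℝ)) (labelCov k P)

variable {P : V → V → ℝ}

lemma labelCov_symm (hP : ∀ i j, P i j = P j i) (a b : V × Fin k) :
    labelCov k P a b = labelCov k P b a := by
  simp only [labelCov, hP a.1 b.1, eq_comm (a := a.2)]

/-- Places the gradient of `singPoly` in the kernel of the covariance. -/
lemma labelCov_sum_right (a : V × Fin k) (j : V) :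
    ∑ c : Fin k, labelCov k P a (j, c) = 0 := by
  simp only [labelCov]
  rw [← Finset.sum_div, ← Finset.mul_sum, Finset.sum_sub_distrib]
  simp

/-- A nonzero mixed derivative certifies that a constraint has degree at least two, so that only
constant multipliers are admissible. -/
lemma pderiv_pderiv_samePoly (i j u v : V) (hij : i ≠ j) (c : Fin k) [DecidableEq V] :
    pderiv (i, c) (pderiv (j, c) (samePoly k u v)) =
      if (u = i ∧ v = j) ∨ (u = j ∧ v = i) then 1 else 0 := by
  classical
  rw [samePoly, map_sum, map_sum, Finset.sum_eq_single c]
  · simp only [pderiv_mul, map_add, pderiv_X, Pi.single_apply, Prod.ext_iff, and_true]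
    by_cases h1 : u = i <;> by_cases h2 : v = j <;> by_cases h3 : u = j <;> by_cases h4 : v = i <;>
      simp_all
  · intro c' _ hc
    simp [pderiv_X, hc]
  · simp

variable [Fintype V]

/-- The covariance is the tensor product of `P` with (1/k)(I - J/k), where J is the all-ones matrix
and I - J/k projects onto vectors of sum zero. Centring `y` over the labels thus turns the form into
1/k times a sum of `P`-forms, one for each label. -/
lemma labelCov_psd (hk : k ≠ 0) (hpsd : ∀ x : V → ℝ, 0 ≤ ∑ i, ∑ j, P i j * (x i * x j))
    (y : V × Fin k → ℝ) : 0 ≤ ∑ a, ∑ b, labelCov k P a b * (y a * y b) := by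
  have hk' : (k : ℝ) ≠ 0 := by exact_mod_cast hk
  set s : V → ℝ := fun i => ∑ c, y (i, c) with hs
  have key (i j : V) : ∑ c, (y (i, c) - s i / k) * (y (j, c) - s j / k) =
      ∑ c, ∑ c', ((if c = c' then (k : ℝ) else 0) - 1) / k * (y (i, c) * y (j, c')) := by
    have h1 : ∑ c, ∑ c', ((if c = c' then (k : ℝ) else 0) - 1) / k * (y (i, c) * y (j, c')) =
        ∑ c, y (i, c) * y (j, c) - s i * s j / k := by
      rw [hs]
      simp only [Finset.sum_mul_sum, Finset.sum_div]
      rw [← Finset.sum_sub_distrib]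
      refine Finset.sum_congr rfl fun c _ => ?_
      simp only [sub_div, sub_mul, Finset.sum_sub_distrib, ite_div, ite_mul, zero_div, zero_mul,
        Finset.sum_ite_eq, Finset.mem_univ, if_true, div_self hk', one_mul]
      congr 1
      exact Finset.sum_congr rfl fun c' _ => by ring
    rw [h1]
    have h2 (c : Fin k) : (y (i, c) - s i / k) * (y (j, c) - s j / k) =
        y (i, c) * y (j, c) - y (i, c) * (s j / k) - s i / k * y (j, c) + s i / k * (s j / k) := by
      ring
    simp only [h2, Finset.sum_add_distrib, Finset.sum_sub_distrib, ← Finset.sum_mul,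
      ← Finset.mul_sum]
    simp only [Finset.sum_const, Finset.card_univ, Fintype.card_fin, nsmul_eq_mul]
    change _ - s i * _ - _ * s j + _ = _
    field_simp
    ring
  have h : ∑ a, ∑ b, labelCov k P a b * (y a * y b) =
      (∑ c, ∑ i, ∑ j, P i j * ((y (i, c) - s i / k) * (y (j, c) - s j / k))) / k := by
    have hcomm : ∑ c, ∑ i, ∑ j, P i j * ((y (i, c) - s i / k) * (y (j, c) - s j / k)) =
        ∑ i, ∑ j, ∑ c, P i j * ((y (i, c) - s i / k) * (y (j, c) - s j / k)) := by
      rw [Finset.sum_comm]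
      exact Finset.sum_congr rfl fun i _ => Finset.sum_comm
    rw [hcomm]
    have hrw (i j : V) : ∑ c, P i j * ((y (i, c) - s i / k) * (y (j, c) - s j / k)) =
        ∑ c, ∑ c', P i j * (((if c = c' then (k : ℝ) else 0) - 1) / k *
          (y (i, c) * y (j, c'))) := by
      rw [← Finset.mul_sum, key]
      simp only [Finset.mul_sum]
    simp only [hrw, Fintype.sum_prod_type, Finset.sum_div, labelCov]
    refine Finset.sum_congr rfl fun i _ => ?_
    rw [Finset.sum_comm]
    refine Finset.sum_congr rfl fun j _ => ?_
    refine Finset.sum_congr rfl fun c _ => Finset.sum_congr rfl fun c' _ => ?_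
    field_simp
  rw [h]
  exact div_nonneg (Finset.sum_nonneg fun c _ => hpsd _) (Nat.cast_nonneg k)

lemma labelExp_samePoly (hk : k ≠ 0) (hP : ∀ i j, P i j = P j i) (i j : V) :
    labelExp k P (samePoly k i j) = (1 + (k - 1) * P i j) / k := by
  have hk' : (k : ℝ) ≠ 0 := by exact_mod_cast hk
  simp only [samePoly, map_sum, pseudoExp_X_mul_X (labelCov_symm hP), labelCov, if_true]
  simp only [Finset.sum_const, Finset.card_univ, Fintype.card_fin, nsmul_eq_mul]
  field_simp

lemma labelExp_mul_boolPoly (hk : 2 ≤ k) (hP : ∀ i j, P i j = P j i) (hdiag : ∀ i, P i i = 1)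
    (i : V) (c : Fin k) {g : MvPolynomial (V × Fin k) ℝ}
    (hg : (g * boolPoly i c).totalDegree ≤ 2) : labelExp k P (g * boolPoly i c) = 0 := by
  have hk' : (k : ℝ) ≠ 0 := by positivity
  refine pseudoExp_mul_eq_zero_of_quadratic (a := (i, c)) (b := (i, c)) ?_ ?_ hg
  · intro h
    have := congrArg (eval 0) h
    simp only [boolPoly, sq, map_sub, pderiv_mul, map_add, pderiv_X_self, pderiv_one, map_one,
      map_zero, mul_one, one_mul, sub_zero] at this
    norm_num at this
  · rw [boolPoly, map_sub, sq, pseudoExp_X_mul_X (labelCov_symm hP), pseudoExp_X]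
    simp only [labelCov, hdiag, if_true]
    field_simp
    ring

lemma labelExp_mul_singPoly (hk : k ≠ 0) (hP : ∀ i j, P i j = P j i)
    (i : V) {g : MvPolynomial (V × Fin k) ℝ}
    (hg : (g * singPoly k i).totalDegree ≤ 2) : labelExp k P (g * singPoly k i) = 0 := by
  classical
  have hk' : (k : ℝ) ≠ 0 := by exact_mod_cast hk
  have hder (b : V × Fin k) : pderiv b (singPoly k i) = if b.1 = i then 1 else 0 := by
    rw [singPoly, map_add, map_neg, map_sum]
    simp only [pderiv_one, neg_zero, zero_add, pderiv_X, Pi.single_apply, Prod.ext_iff]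
    split_ifs with h
    · simp [h]
    · simp [Ne.symm h]
  have hne : (singPoly k i).totalDegree ≠ 0 := by
    intro h
    have h1 := hder (i, ⟨0, Nat.pos_of_ne_zero hk⟩)
    rw [totalDegree_eq_zero_iff_eq_C.mp h, pderiv_C] at h1
    simp at h1
  have hle : (singPoly k i).totalDegree ≤ 1 := by
    refine (totalDegree_add _ _).trans (max_le (by simp) ?_)
    exact totalDegree_finsetSum_le fun c _ => by simp
  refine pseudoExp_mul_eq_zero_of_affine (labelCov_symm hP) ?_ (by omega) ?_ (fun a => ?_) hg
  · intro h
    simp [h] at hne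
  · simp [singPoly, hk']
  · rw [Fintype.sum_prod_type]
    refine (Finset.sum_eq_single i (fun j _ hj => ?_) (by simp)).trans ?_
    · simp [hder, hj]
    · simpa [hder] using labelCov_sum_right a i

lemma labelExp_mul_samePoly (hk : k ≠ 0) (hP : ∀ i j, P i j = P j i) {i j : V} (hij : i ≠ j)
    (h : (k - 1) * P i j = -1) {g : MvPolynomial (V × Fin k) ℝ}
    (hg : (g * samePoly k i j).totalDegree ≤ 2) : labelExp k P (g * samePoly k i j) = 0 := by
  classical
  let c : Fin k := ⟨0, Nat.pos_of_ne_zero hk⟩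
  refine pseudoExp_mul_eq_zero_of_quadratic (a := (i, c)) (b := (j, c)) ?_ ?_ hg
  · simp [pderiv_pderiv_samePoly, hij]
  · rw [labelExp_samePoly hk hP, h]
    simp

lemma labelExp_mul_of_mem_labelSystem (hk : 2 ≤ k) (hP : ∀ i j, P i j = P j i)
    (hdiag : ∀ i, P i i = 1) {f g : MvPolynomial (V × Fin k) ℝ} (hf : f ∈ labelSystem V k)
    (hg : (g * f).totalDegree ≤ 2) : labelExp k P (g * f) = 0 := by
  rcases hf with ⟨i, c, rfl⟩ | ⟨i, rfl⟩
  · exact labelExp_mul_boolPoly hk hP hdiag i c hg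
  · exact labelExp_mul_singPoly (by omega) hP i hg

/-- A vector `k`-colouring rules out degree-two refutations of `k`-colourability. -/
lemma not_hasSOSRefutation_coloringSystem (G : SimpleGraph V) (hk : 2 ≤ k)
    (hP : ∀ i j, P i j = P j i) (hdiag : ∀ i, P i i = 1)
    (hpsd : ∀ x : V → ℝ, 0 ≤ ∑ i, ∑ j, P i j * (x i * x j))
    (hedge : ∀ i j, G.Adj i j → (k - 1) * P i j = -1) :
    ¬ HasSOSRefutation 2 (coloringSystem G k) := by
  refine not_hasSOSRefutation_of_pseudoExp (μ := fun _ => 1 / (k : ℝ)) (labelCov_symm hP) (labelCov_psd (by omega) hpsd)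
    fun f hf g hg => ?_
  rcases hf with hf | ⟨i, j, hij, rfl⟩
  · exact labelExp_mul_of_mem_labelSystem hk hP hdiag hf hg
  · exact labelExp_mul_samePoly (by omega) hP hij.ne (hedge i j hij) hg

lemma SimpleGraph.sum_adjMatrix_eq_two_mul_ncard_edgeSet (G : SimpleGraph V) [DecidableRel G.Adj] :
    ∑ i, ∑ j, G.adjMatrix ℝ i j = 2 * (G.edgeSet.ncard : ℝ) := by
  classical
  have h : ∀ i, ∑ j, G.adjMatrix ℝ i j = G.degree i := fun i => by
    simp [SimpleGraph.adjMatrix_apply, SimpleGraph.card_neighborFinset_eq_degree,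
      ← SimpleGraph.neighborFinset_eq_filter]
  simp only [h]
  rw [← Nat.cast_sum, G.sum_degrees_eq_twice_card_edges, ← SimpleGraph.coe_edgeFinset,
    Set.ncard_coe_finset]
  push_cast
  rfl

/-- Each edge has agreement pseudoprobability τ/k, hence so does the average over edges. An edge is
needed both for this average to make sense and for the cut constraint to be truly quadratic. -/
lemma not_hasSOSRefutation_goodPartitionSystem (G : SimpleGraph V) {τ : ℝ} (hk : 2 ≤ k)
    (hP : ∀ i j, P i j = P j i) (hdiag : ∀ i, P i i = 1)
    (hpsd : ∀ x : V → ℝ, 0 ≤ ∑ i, ∑ j, P i j * (x i * x j))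
    (hedge : ∀ i j, G.Adj i j → (k - 1) * P i j = τ - 1) (hne : G ≠ ⊥) :
    ¬ HasSOSRefutation 2 (goodPartitionSystem G k τ) := by
  classical
  refine not_hasSOSRefutation_of_pseudoExp (μ := fun _ => 1 / (k : ℝ)) (labelCov_symm hP) (labelCov_psd (by omega) hpsd)
    fun f hf g hg => ?_
  rcases hf with hf | rfl
  · exact labelExp_mul_of_mem_labelSystem hk hP hdiag hf hg
  obtain ⟨u, v, huv⟩ : ∃ u v, G.Adj u v := by
    by_contra! h
    exact hne (by ext u v; simp [h])
  have hm : (G.edgeSet.ncard : ℝ) ≠ 0 := by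
    have : G.edgeSet.ncard ≠ 0 := by
      exact ((Set.ncard_pos (Set.toFinite _)).mpr ⟨s(u, v), huv⟩).ne'
    exact_mod_cast this
  have hk0 : k ≠ 0 := by omega
  have hk' : (k : ℝ) ≠ 0 := by exact_mod_cast hk0
  let c : Fin k := ⟨0, Nat.pos_of_ne_zero hk0⟩
  refine pseudoExp_mul_eq_zero_of_quadratic (a := (u, c)) (b := (v, c)) ?_ ?_ hg
  · intro h
    have h1 := congrArg (eval 0) h
    simp only [cutPoly, map_add, map_neg, pderiv_C, pderiv_C_mul, map_sum,
      pderiv_pderiv_samePoly _ _ _ _ huv.ne, map_zero, neg_zero, zero_add, map_mul, eval_C,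
      apply_ite, map_one] at h1
    have h2 : ∑ i, ∑ j, (G.adjMatrix ℝ i j * if (i = u ∧ j = v) ∨ (i = v ∧ j = u) then (1 : ℝ)
        else 0) ≠ 0 := by
      apply ne_of_gt
      have hnn (i j : V) : 0 ≤ G.adjMatrix ℝ i j *
          if (i = u ∧ j = v) ∨ (i = v ∧ j = u) then (1 : ℝ) else 0 := by
        rw [SimpleGraph.adjMatrix_apply]
        split_ifs <;> simp
      refine Finset.sum_pos' (fun i _ => Finset.sum_nonneg fun j _ => hnn i j)
        ⟨u, Finset.mem_univ _, Finset.sum_pos' (fun j _ => hnn u j) ⟨v, Finset.mem_univ _, ?_⟩⟩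
      simp [huv]
    rcases mul_eq_zero.mp h1 with h3 | h3
    · simp [hm] at h3
    · exact h2 (by simpa only [mul_ite] using h3)
  · rw [cutPoly, map_add, map_neg, pseudoExp_C, pseudoExp_C_mul]
    simp only [map_sum, pseudoExp_C_mul, labelExp_samePoly hk0 hP]
    have hrw (i j : V) : G.adjMatrix ℝ i j * ((1 + ((k : ℝ) - 1) * P i j) / k) =
        G.adjMatrix ℝ i j * (τ / k) := by
      by_cases hij : G.Adj i j
      · rw [hedge i j hij]
        ring
      · simp [SimpleGraph.adjMatrix_apply, hij]
    have hs := G.sum_adjMatrix_eq_two_mul_ncard_edgeSet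
    refine Eq.trans (congrArg (fun s => -(τ / (k : ℝ)) + 1 / (2 * (G.edgeSet.ncard : ℝ)) * s)
      (Finset.sum_congr rfl fun i _ => Finset.sum_congr rfl fun j _ => hrw i j)) ?_
    simp only [← Finset.sum_mul]
    rw [hs]
    field_simp
    ring

end Labellings

/-! ### Telescoping sums of radial functions. -/

section Radial

open Finset Classical

variable {V : Type*} [Fintype V]

/-- Summation of a radial function around a set of roots (the zeros of `m`) near which the graph
is a tree: the contributions telescope. -/
lemma SimpleGraph.sum_radial (H : SimpleGraph V) (m : V → ℕ) {L : ℕ} {g : ℕ → ℝ}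
    (hg : ∀ r, L < r → g r = 0)
    (h1 : ∀ w, 0 < m w → m w ≤ L → #{u | H.Adj w u ∧ m u + 1 = m w} = 1)
    (h2 : ∀ u w, H.Adj u w → m u = m w → m w + 1 ≤ L → m w = 0)
    (h3 : ∀ u w, H.Adj u w → m u ≤ m w + 1) :
    ∑ w, (g (m w) + (1 - (H.degree w : ℝ)) * g (m w + 1)) =
      ∑ w with m w = 0, (g 0 + (1 - (#{u | H.Adj w u ∧ m u = 0} : ℝ)) * g 1) := by
  have hdeg (w : V) : (H.degree w : ℝ) * g (m w + 1) =
      ∑ u, if H.Adj w u then g (m w + 1) else 0 := by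
    rw [← sum_filter, sum_const, nsmul_eq_mul, ← H.neighborFinset_eq_filter,
      H.card_neighborFinset_eq_degree]
  -- Oriented edges from `w` to `u` lead to a child, to the parent, or between two roots; `h2`
  -- excludes other horizontal edges. Beyond level `L` every term vanishes.
  have hsplit (w u : V) : (if H.Adj w u then g (m w + 1) else 0) =
      (if H.Adj u w ∧ m w + 1 = m u then g (m u) else 0) +
      (if H.Adj w u ∧ m u + 1 = m w then g (m w + 1) else 0) +
      (if m w = 0 then (if H.Adj w u ∧ m u = 0 then g 1 else 0) else 0) := by
    by_cases ha : H.Adj w u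
    swap
    · simp [ha, H.adj_comm u w]
    have ha' := ha.symm
    by_cases hL : m w + 1 ≤ L
    · have e1 := h3 _ _ ha
      have e2 := h3 _ _ ha'
      have e3 := h2 _ _ ha'
      simp only [ha, ha', true_and, if_true]
      rcases lt_trichotomy (m u) (m w) with h | h | h
      · rw [if_neg (by omega), if_pos (by omega), if_neg (by omega)]
        simp
      · have h0 := e3 h hL
        rw [if_neg (by omega), if_neg (by omega), if_pos h0, if_pos (by omega), h0]
        simp
      · have h0 : m w + 1 = m u := by omega
        rw [if_pos h0, if_neg (by omega), h0]
        by_cases hw : m w = 0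
        · rw [if_pos hw, if_neg (by omega)]; simp
        · rw [if_neg hw]; simp
    · have z1 : g (m w + 1) = 0 := hg _ (by omega)
      simp only [ha, ha', true_and, z1, ite_self, add_zero]
      by_cases hu : m w + 1 = m u
      · rw [if_pos hu, ← hu, z1]
        by_cases hw : m w = 0
        · rw [if_pos hw, if_neg (by omega)]; simp
        · rw [if_neg hw]; simp
      · rw [if_neg hu]
        by_cases hw : m w = 0
        · rw [hw] at z1
          simp only [zero_add] at z1
          simp [z1]
        · rw [if_neg hw]; simp
  have s1 (u : V) : (∑ w, if H.Adj u w ∧ m w + 1 = m u then g (m u) else 0) =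
      if m u = 0 then 0 else g (m u) := by
    rw [← sum_filter, sum_const, nsmul_eq_mul]
    split_ifs with h0
    · simp [h0]
    · by_cases hL : m u ≤ L
      · rw [h1 u (by omega) hL]; simp
      · rw [hg _ (by omega)]; simp
  have s2 (w : V) : (∑ u, if H.Adj w u ∧ m u + 1 = m w then g (m w + 1) else 0) =
      if m w = 0 then 0 else g (m w + 1) := by
    rw [← sum_filter, sum_const, nsmul_eq_mul]
    split_ifs with h0
    · simp [h0]
    · by_cases hL : m w ≤ L
      · rw [h1 w (by omega) hL]; simp
      · rw [hg _ (by omega)]; simp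
  have s3 (w : V) : (∑ u, if m w = 0 then (if H.Adj w u ∧ m u = 0 then g 1 else 0) else 0) =
      if m w = 0 then (#{u | H.Adj w u ∧ m u = 0} : ℝ) * g 1 else 0 := by
    split_ifs with h0
    · rw [← sum_filter, sum_const, nsmul_eq_mul]
    · simp
  have htot : ∑ w, (H.degree w : ℝ) * g (m w + 1) =
      ∑ w, ((if m w = 0 then 0 else g (m w)) + (if m w = 0 then 0 else g (m w + 1)) +
        if m w = 0 then (#{u | H.Adj w u ∧ m u = 0} : ℝ) * g 1 else 0) := by
    simp only [hdeg, hsplit, sum_add_distrib]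
    rw [sum_comm]
    simp only [s1, s2, s3]
  have hl : ∑ w, (g (m w) + (1 - (H.degree w : ℝ)) * g (m w + 1)) =
      ∑ w, (g (m w) + g (m w + 1)) - ∑ w, (H.degree w : ℝ) * g (m w + 1) := by
    rw [← sum_sub_distrib]
    exact sum_congr rfl fun w _ => by ring
  rw [hl, htot, ← sum_sub_distrib, sum_filter]
  refine sum_congr rfl fun w _ => ?_
  split_ifs with h0
  · rw [h0]; ring
  · ring

end Radial

/-! ### Balls in locally sparse graphs are trees. -/

section LocallySparse

open Finset Classical

variable {V : Type*}

/-- The edges of `G` with both endpoints in `W`. -/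
def SimpleGraph.edgesWithin (G : SimpleGraph V) (W : Finset V) : Finset (Sym2 V) :=
  {e ∈ W.sym2 | e ∈ G.edgeSet}

lemma SimpleGraph.mk_mem_edgesWithin {G : SimpleGraph V} {W : Finset V} {u v : V} :
    s(u, v) ∈ G.edgesWithin W ↔ (u ∈ W ∧ v ∈ W) ∧ G.Adj u v := by
  simp [edgesWithin]

/-- Every nonempty set of at most `M` vertices spans fewer edges than it has vertices. -/
def SimpleGraph.LocallySparse (G : SimpleGraph V) (M : ℕ) : Prop :=
  ∀ W : Finset V, W.Nonempty → #W ≤ M → #(G.edgesWithin W) < #W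

/-- The graph distance, with the value `N` for unreachable vertices. -/
def SimpleGraph.distOr (G : SimpleGraph V) (N : ℕ) (i w : V) : ℕ :=
  if G.Reachable i w then G.dist i w else N

namespace SimpleGraph

variable {G : SimpleGraph V} {N L : ℕ} {i j u w : V}

lemma distOr_comm : G.distOr N i w = G.distOr N w i := by
  simp only [distOr, G.reachable_comm (u := i), G.dist_comm (u := i)]

lemma distOr_eq_zero_iff (hN : 0 < N) : G.distOr N i w = 0 ↔ i = w := by
  unfold distOr
  split_ifs with h
  · exact h.dist_eq_zero_iff
  · constructor
    · omega
    · rintro rfl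
      exact absurd (Reachable.refl _) h

lemma distOr_le_of_adj (h : G.Adj u w) : G.distOr N i u ≤ G.distOr N i w + 1 := by
  unfold distOr
  by_cases hw : G.Reachable i w
  · have hu : G.Reachable i u := hw.trans h.symm.reachable
    rw [if_pos hu, if_pos hw]
    obtain ⟨p, hp⟩ := hw.exists_walk_length_eq_dist
    rw [← hp]
    simpa using G.dist_le (p.concat h.symm)
  · have hu : ¬ G.Reachable i u := fun hu => hw (hu.trans h.reachable)
    rw [if_neg hu, if_neg hw]
    omega

lemma exists_adj_distOr (h0 : 0 < G.distOr N i w) (hN : G.distOr N i w < N) :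
    ∃ u, G.Adj w u ∧ G.distOr N i u + 1 = G.distOr N i w := by
  have hw : G.Reachable i w := by
    by_contra h
    simp [distOr, h] at hN
  obtain ⟨p, hp⟩ := hw.symm.exists_walk_length_eq_dist
  have hd : G.distOr N i w = p.length := by
    rw [hp, distOr, if_pos hw, G.dist_comm]
  cases p with
  | nil => simp [hd] at h0
  | @cons _ u _ h q =>
    refine ⟨u, h, le_antisymm ?_ (distOr_le_of_adj h)⟩
    rw [hd, Walk.length_cons, distOr, if_pos q.reachable.symm, G.dist_comm]
    exact Nat.succ_le_succ (G.dist_le q)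

/-- In a locally sparse graph, every edge of a ball joins a vertex to its parent. -/
lemma LocallySparse.eq_parent_or_eq_parent (hG : G.LocallySparse (2 * L + 2)) (hLN : L < N)
    {p : V → V} (hp : ∀ w, 0 < G.distOr N i w → G.distOr N i w < N →
      G.Adj w (p w) ∧ G.distOr N i (p w) + 1 = G.distOr N i w)
    (huw : G.Adj u w) (hu : G.distOr N i u ≤ L) (hw : G.distOr N i w ≤ L) :
    0 < G.distOr N i w ∧ u = p w ∨ 0 < G.distOr N i u ∧ w = p u := by
  -- Otherwise let `W` be the union of the parent paths from `u` and `w` to `i`. It has at most 2L +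
  -- 2 vertices, and besides its #W - 1 parent edges it spans the edge `uw`, against local sparsity.
  by_contra! hcon
  set D := G.distOr N i with hD
  have hiter : ∀ x, D x ≤ L → ∀ t, t ≤ D x → D (p^[t] x) = D x - t := by
    intro x hx t
    induction t with
    | zero => simp
    | succ t ih =>
      intro ht
      rw [Function.iterate_succ_apply']
      have := ih (by omega)
      have := (hp (p^[t] x) (by omega) (by omega)).2
      omega
  let T : V → Finset V := fun x => (range (D x + 1)).image fun t => p^[t] x
  have hTcard (x : V) : #(T x) ≤ D x + 1 := card_image_le.trans (by simp)
  have hTD (x : V) (hx : D x ≤ L) : ∀ y ∈ T x, D y ≤ L := by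
    intro y hy
    obtain ⟨t, ht, rfl⟩ := mem_image.mp hy
    rw [mem_range] at ht
    rw [hiter x hx t (by omega)]
    omega
  have hTp (x : V) (hx : D x ≤ L) : ∀ y ∈ T x, 0 < D y → p y ∈ T x := by
    intro y hy h0
    obtain ⟨t, ht, rfl⟩ := mem_image.mp hy
    rw [mem_range] at ht
    rw [hiter x hx t (by omega)] at h0
    refine mem_image.mpr ⟨t + 1, mem_range.mpr (by omega), ?_⟩
    rw [Function.iterate_succ_apply']
  have hTself (x : V) : x ∈ T x := mem_image.mpr ⟨0, by simp, rfl⟩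
  have hTi (x : V) (hx : D x ≤ L) : i ∈ T x := by
    refine mem_image.mpr ⟨D x, by simp, ?_⟩
    have := hiter x hx (D x) le_rfl
    rw [Nat.sub_self, hD, distOr_eq_zero_iff (by omega)] at this
    exact this.symm
  set W := T u ∪ T w with hW
  have hWD : ∀ y ∈ W, D y ≤ L := fun y hy =>
    (mem_union.mp hy).elim (hTD u hu y) (hTD w hw y)
  have hWp : ∀ y ∈ W, 0 < D y → p y ∈ W := fun y hy h0 =>
    (mem_union.mp hy).elim (fun h => mem_union_left _ (hTp u hu y h h0))
      (fun h => mem_union_right _ (hTp w hw y h h0))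
  have hWi : i ∈ W := mem_union_left _ (hTi u hu)
  have hpos : ∀ y ∈ W.erase i, 0 < D y := fun y hy => by
    rw [Nat.pos_iff_ne_zero, hD, Ne, distOr_eq_zero_iff (by omega)]
    exact (ne_of_mem_erase hy).symm
  have hWcard : #W ≤ 2 * L + 2 := by
    calc #W ≤ #(T u) + #(T w) := card_union_le _ _
      _ ≤ (L + 1) + (L + 1) := add_le_add ((hTcard u).trans (Nat.succ_le_succ hu))
          ((hTcard w).trans (Nat.succ_le_succ hw))
      _ = 2 * L + 2 := by ring
  have hsub : insert s(u, w) ((W.erase i).image fun y => s(y, p y)) ⊆ G.edgesWithin W := by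
    intro e he
    rcases mem_insert.mp he with rfl | he
    · exact mk_mem_edgesWithin.mpr
        ⟨⟨mem_union_left _ (hTself u), mem_union_right _ (hTself w)⟩, huw⟩
    · obtain ⟨y, hy, rfl⟩ := mem_image.mp he
      have hyW := mem_of_mem_erase hy
      have h0 := hpos y hy
      exact mk_mem_edgesWithin.mpr ⟨⟨hyW, hWp y hyW h0⟩,
        (hp y h0 (lt_of_le_of_lt (hWD y hyW) hLN)).1⟩
  have hinj : Set.InjOn (fun y => s(y, p y)) (W.erase i : Finset V) := by
    intro y hy z hz hyz
    rcases Sym2.eq_iff.mp hyz with h | ⟨h1, h2⟩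
    · exact h.1
    · exfalso
      have e1 := (hp y (hpos y hy) (lt_of_le_of_lt (hWD y (mem_of_mem_erase hy)) hLN)).2
      have e2 := (hp z (hpos z hz) (lt_of_le_of_lt (hWD z (mem_of_mem_erase hz)) hLN)).2
      rw [h2] at e1
      rw [← h1] at e2
      omega
  have hnot : s(u, w) ∉ (W.erase i).image fun y => s(y, p y) := by
    intro h
    obtain ⟨y, hy, hyuw⟩ := mem_image.mp h
    have h0 := hpos y hy
    rcases Sym2.eq_iff.mp hyuw with ⟨h1, h2⟩ | ⟨h1, h2⟩
    · subst h1
      exact hcon.2 h0 h2.symm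
    · subst h1
      exact hcon.1 h0 h2.symm
  have h1 := card_le_card hsub
  rw [card_insert_of_notMem hnot, card_image_of_injOn hinj, card_erase_of_mem hWi] at h1
  have h2 := hG W ⟨i, hWi⟩ hWcard
  have h3 : 0 < #W := card_pos.mpr ⟨i, hWi⟩
  omega

/-- Both endpoints lie in the ball if the distances agree, and an edge to a parent changes the
distance by one. -/
lemma LocallySparse.distOr_ne_of_adj (hG : G.LocallySparse (2 * L + 2)) (hLN : L < N)
    (huw : G.Adj u w) (hw : G.distOr N i w ≤ L) : G.distOr N i u ≠ G.distOr N i w := by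
  intro heq
  choose! p hp using fun w (h : 0 < G.distOr N i w ∧ G.distOr N i w < N) =>
    exists_adj_distOr h.1 h.2
  have hp' := fun w h0 hN => hp w ⟨h0, hN⟩
  rcases hG.eq_parent_or_eq_parent hLN hp' huw (by omega) hw with ⟨h0, h⟩ | ⟨h0, h⟩
  · have := (hp' w h0 (by omega)).2
    rw [← h] at this
    omega
  · have := (hp' u h0 (by omega)).2
    rw [← h] at this
    omega

lemma LocallySparse.parent_unique (hG : G.LocallySparse (2 * L + 2)) (hLN : L < N)
    (hw : G.distOr N i w ≤ L) (hu : G.Adj w u) (hdu : G.distOr N i u + 1 = G.distOr N i w)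
    (hj : G.Adj w j) (hdj : G.distOr N i j + 1 = G.distOr N i w) : u = j := by
  choose! p hp using fun w (h : 0 < G.distOr N i w ∧ G.distOr N i w < N) =>
    exists_adj_distOr h.1 h.2
  have hp' := fun w h0 hN => hp w ⟨h0, hN⟩
  have key : ∀ v, G.Adj w v → G.distOr N i v + 1 = G.distOr N i w → v = p w := by
    intro v hv hdv
    rcases hG.eq_parent_or_eq_parent hLN hp' hv.symm (by omega) hw with ⟨_, h⟩ | ⟨h0, h⟩
    · exact h
    · have := (hp' v h0 (by omega)).2
      rw [← h] at this
      omega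
  rw [key u hu hdu, key j hj hdj]

lemma LocallySparse.card_parents [Fintype V] (hG : G.LocallySparse (2 * L + 2)) (hLN : L < N)
    (h0 : 0 < G.distOr N i w) (hw : G.distOr N i w ≤ L) :
    #{u | G.Adj w u ∧ G.distOr N i u + 1 = G.distOr N i w} = 1 := by
  obtain ⟨p, hp⟩ := exists_adj_distOr h0 (lt_of_le_of_lt hw hLN)
  refine card_eq_one.mpr ⟨p, ?_⟩
  ext u
  simp only [mem_filter, mem_univ, true_and, mem_singleton]
  exact ⟨fun hu => hG.parent_unique hLN hw hu.1 hu.2 hp.1 hp.2, by rintro rfl; exact hp⟩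

end SimpleGraph

end LocallySparse

/-! ### The Gram matrix of truncated powers of the distance on a tree. -/

section TreeGram

open Finset Classical

/-- The powers of `x` with exponent at most `L`. -/
def truncPow (x : ℝ) (L r : ℕ) : ℝ := if r ≤ L then x ^ r else 0

lemma truncPow_of_lt {x : ℝ} {L r : ℕ} (h : L < r) : truncPow x L r = 0 := by
  simp [truncPow, h]

/-- The function g(r) = x^(2r) (L + 1 - r) is the total of the squares over a full q-ary branch
rooted at level r: since q x² = 1, each of its L + 1 - r levels contributes x^(2r). Truncated
subtraction makes it vanish beyond `L`. -/
lemma truncPow_sq {x q : ℝ} (hq : q * x ^ 2 = 1) (L r : ℕ) :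
    truncPow x L r * truncPow x L r =
      x ^ (2 * r) * ((L + 1 - r : ℕ) : ℝ) - q * (x ^ (2 * (r + 1)) * ((L + 1 - (r + 1) : ℕ) : ℝ)) := by
  unfold truncPow
  split_ifs with h
  · rw [Nat.cast_sub (by omega), Nat.cast_sub (by omega)]
    push_cast
    linear_combination (x ^ (2 * r) * (L - r)) * hq
  · rw [Nat.sub_eq_zero_of_le (by omega), Nat.sub_eq_zero_of_le (by omega)]
    simp

/-- The analogous branch total for a vertex whose distances to the two ends of an edge are r and r +
1. -/
lemma truncPow_mul_succ {x q : ℝ} (hq : q * x ^ 2 = 1) (L r : ℕ) :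
    truncPow x L r * truncPow x L (r + 1) =
      x ^ (2 * r + 1) * ((L - r : ℕ) : ℝ) - q * (x ^ (2 * (r + 1) + 1) * ((L - (r + 1) : ℕ) : ℝ)) := by
  unfold truncPow
  by_cases h : r + 1 ≤ L
  · rw [if_pos h, if_pos (by omega), Nat.cast_sub (by omega), Nat.cast_sub (by omega)]
    push_cast
    linear_combination (x ^ (2 * r + 1) * (L - r - 1)) * hq
  · rw [if_neg h, Nat.sub_eq_zero_of_le (by omega), Nat.sub_eq_zero_of_le (by omega)]
    simp

/-- Recovers the branch total `g` from the contribution `h` of a single vertex, a q-ary branch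
having q^s vertices at depth s. -/
lemma sum_geometric_telescope {q : ℝ} {g h : ℕ → ℝ} {L : ℕ} (hg : ∀ r, L < r → g r = 0)
    (hh : ∀ r, h r = g r - q * g (r + 1)) (r : ℕ) :
    ∑ s ∈ range (L + 1), q ^ s * h (r + s) = g r := by
  have h1 (s : ℕ) : q ^ s * h (r + s) = q ^ s * g (r + s) - q ^ (s + 1) * g (r + (s + 1)) := by
    rw [hh, add_assoc]
    ring
  simp only [h1]
  rw [sum_range_sub' fun s => q ^ s * g (r + s)]
  simp [hg (r + (L + 1)) (by omega)]

variable {V : Type*} [Fintype V]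

/-- The Gram matrix of the vectors whose coordinate at a vertex `w` is `x` to the power of the
distance to `w`, truncated at `L`, computed as if further branches were attached
to make `H` a `q + 1`-regular tree near each vertex. -/
def treeGram (H : SimpleGraph V) (q x : ℝ) (L : ℕ) (i j : V) : ℝ :=
  ∑ w, (truncPow x L (H.distOr (L + 1) i w) * truncPow x L (H.distOr (L + 1) j w) +
    (q + 1 - H.degree w) * ∑ s ∈ range (L + 1), q ^ s *
      (truncPow x L (H.distOr (L + 1) i w + 1 + s) * truncPow x L (H.distOr (L + 1) j w + 1 + s)))

variable {H : SimpleGraph V} {q x : ℝ} {L : ℕ}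

lemma treeGram_comm (i j : V) : treeGram H q x L i j = treeGram H q x L j i := by
  unfold treeGram
  refine sum_congr rfl fun w _ => ?_
  rw [mul_comm (truncPow x L (H.distOr (L + 1) i w))]
  congr 2
  exact sum_congr rfl fun s _ => by ring

lemma sum_sum_mul_mul_nonneg (f : V → ℝ) (y : V → ℝ) :
    0 ≤ ∑ i, ∑ j, f i * f j * (y i * y j) := by
  have : ∑ i, ∑ j, f i * f j * (y i * y j) = (∑ i, f i * y i) * ∑ j, f j * y j := by
    rw [sum_mul_sum]
    exact sum_congr rfl fun i _ => sum_congr rfl fun j _ => by ring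
  rw [this]
  exact mul_self_nonneg _

/-- A sum of rank-one forms whose weights are nonnegative because the number q + 1 - deg(w) of
attached branches is. -/
lemma treeGram_psd (hq : 0 ≤ q) (hdeg : ∀ w, (H.degree w : ℝ) ≤ q + 1) (y : V → ℝ) :
    0 ≤ ∑ i, ∑ j, treeGram H q x L i j * (y i * y j) := by
  have h : ∑ i, ∑ j, treeGram H q x L i j * (y i * y j) =
      ∑ w, ((∑ i, ∑ j, truncPow x L (H.distOr (L + 1) i w) *
          truncPow x L (H.distOr (L + 1) j w) * (y i * y j)) +
        (q + 1 - H.degree w) * ∑ s ∈ range (L + 1), q ^ s *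
          ∑ i, ∑ j, truncPow x L (H.distOr (L + 1) i w + 1 + s) *
            truncPow x L (H.distOr (L + 1) j w + 1 + s) * (y i * y j)) := by
    simp only [treeGram, sum_mul, add_mul, sum_add_distrib, mul_sum]
    congr 1
    · calc _ = ∑ i, ∑ w, ∑ j, truncPow x L (H.distOr (L + 1) i w) *
          truncPow x L (H.distOr (L + 1) j w) * (y i * y j) :=
            sum_congr rfl fun i _ => sum_comm
        _ = _ := sum_comm
    · calc _ = ∑ i, ∑ w, ∑ s ∈ range (L + 1), ∑ j, (q + 1 - (H.degree w : ℝ)) * (q ^ s *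
            (truncPow x L (H.distOr (L + 1) i w + 1 + s) *
              truncPow x L (H.distOr (L + 1) j w + 1 + s))) * (y i * y j) := by
            refine sum_congr rfl fun i _ => sum_comm.trans (sum_congr rfl fun w _ => sum_comm)
        _ = ∑ w, ∑ s ∈ range (L + 1), ∑ i, ∑ j, (q + 1 - (H.degree w : ℝ)) * (q ^ s *
            (truncPow x L (H.distOr (L + 1) i w + 1 + s) *
              truncPow x L (H.distOr (L + 1) j w + 1 + s))) * (y i * y j) :=
            sum_comm.trans (sum_congr rfl fun w _ => sum_comm)
        _ = _ := by
            refine sum_congr rfl fun w _ => sum_congr rfl fun s _ => sum_congr rfl fun i _ =>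
              sum_congr rfl fun j _ => by ring
  rw [h]
  refine sum_nonneg fun w _ => add_nonneg (sum_sum_mul_mul_nonneg _ _) ?_
  refine mul_nonneg (by linarith [hdeg w]) (sum_nonneg fun s _ => ?_)
  exact mul_nonneg (pow_nonneg hq _) (sum_sum_mul_mul_nonneg _ _)

/-- If the products of coordinates depend only on a radial coordinate `m`, the Gram entry is a
radial sum. -/
lemma treeGram_eq_sum_radial {g : ℕ → ℝ} (hg : ∀ r, L < r → g r = 0) {i j : V} {m : V → ℕ}
    (h : ∀ w s, truncPow x L (H.distOr (L + 1) i w + s) * truncPow x L (H.distOr (L + 1) j w + s) =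
      g (m w + s) - q * g (m w + s + 1)) :
    treeGram H q x L i j = ∑ w, (g (m w) + (1 - (H.degree w : ℝ)) * g (m w + 1)) := by
  unfold treeGram
  refine sum_congr rfl fun w _ => ?_
  have h1 : ∑ s ∈ range (L + 1), q ^ s * (truncPow x L (H.distOr (L + 1) i w + 1 + s) *
      truncPow x L (H.distOr (L + 1) j w + 1 + s)) = g (m w + 1) := by
    rw [← sum_geometric_telescope (q := q) hg (fun r => rfl) (m w + 1)]
    refine sum_congr rfl fun s _ => ?_
    have h1 := h w (1 + s)
    simp only [← add_assoc] at h1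
    rw [h1]
  rw [h1]
  have h0 := h w 0
  simp only [add_zero] at h0
  rw [h0]
  ring

/-- In the completed tree, level r ≥ 1 has (q + 1) q^(r-1) vertices of weight x^(2r) and so
contributes 1 + x², while the root contributes 1. -/
lemma treeGram_self (hH : H.LocallySparse (2 * L + 2)) (hq : q * x ^ 2 = 1) (i : V) :
    treeGram H q x L i i = (L + 1) + x ^ 2 * L := by
  have hg : ∀ r, L < r → x ^ (2 * r) * ((L + 1 - r : ℕ) : ℝ) = 0 := fun r hr => by
    rw [Nat.sub_eq_zero_of_le (by omega)]; simp
  rw [treeGram_eq_sum_radial (g := fun r => x ^ (2 * r) * ((L + 1 - r : ℕ) : ℝ)) hg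
    (m := H.distOr (L + 1) i) fun w s => truncPow_sq hq L _]
  rw [H.sum_radial (H.distOr (L + 1) i) hg (fun w h0 hw => hH.card_parents (by omega) h0 hw)
    (fun u w huw heq hw => absurd heq (hH.distOr_ne_of_adj (by omega) huw (by omega)))
    fun u w huw => SimpleGraph.distOr_le_of_adj huw]
  have hroot (w : V) : H.distOr (L + 1) i w = 0 ↔ w = i := by
    rw [SimpleGraph.distOr_eq_zero_iff (by omega), eq_comm]
  simp only [hroot]
  rw [sum_filter, sum_ite_eq' univ i]
  have : #{u | H.Adj i u ∧ u = i} = 0 := by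
    rw [card_eq_zero, filter_eq_empty_iff]
    rintro u - ⟨h, rfl⟩
    exact H.irrefl h
  simp [this]

/-- On either side of the edge there are q^r vertices at depth r in the completed tree, each with
product x^(2r+1); every depth r < L thus contributes x per side. -/
lemma treeGram_of_adj (hH : H.LocallySparse (2 * L + 2)) (hq : q * x ^ 2 = 1) {i j : V}
    (hij : H.Adj i j) : treeGram H q x L i j = 2 * x * L := by
  have hsymm (a b : V) : H.distOr (L + 1) a b = H.distOr (L + 1) b a := SimpleGraph.distOr_comm
  have hzero (a b : V) : H.distOr (L + 1) a b = 0 ↔ a = b :=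
    SimpleGraph.distOr_eq_zero_iff (by omega)
  have hlip (a b w : V) (h : H.Adj a b) : H.distOr (L + 1) w a ≤ H.distOr (L + 1) w b + 1 :=
    SimpleGraph.distOr_le_of_adj h
  have hne (a b w : V) (h : H.Adj a b) (hL : H.distOr (L + 1) w b ≤ L) :
      H.distOr (L + 1) w a ≠ H.distOr (L + 1) w b := hH.distOr_ne_of_adj (by omega) h hL
  have huniq (w a b v : V) (ha : H.Adj v a) (hb : H.Adj v b) (hL : H.distOr (L + 1) w v ≤ L)
      (h1 : H.distOr (L + 1) w a + 1 = H.distOr (L + 1) w v)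
      (h2 : H.distOr (L + 1) w b + 1 = H.distOr (L + 1) w v) : a = b :=
    hH.parent_unique (by omega) hL ha h1 hb h2
  have hex (a w : V) (h0 : 0 < H.distOr (L + 1) a w) (hL : H.distOr (L + 1) a w < L + 1) :
      ∃ v, H.Adj w v ∧ H.distOr (L + 1) a v + 1 = H.distOr (L + 1) a w :=
    SimpleGraph.exists_adj_distOr h0 hL
  set D := H.distOr (L + 1) with hD
  have hDij (w : V) (h : D i w ≤ L ∨ D j w ≤ L) : D i w + 1 = D j w ∨ D j w + 1 = D i w := by
    have e1 := hlip i j w hij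
    have e2 := hlip j i w hij.symm
    have e3 := hne i j w hij
    have e4 := hne j i w hij.symm
    rw [hsymm i w, hsymm j w] at *
    omega
  -- The radial coordinate is the distance to the edge `ij`, which has two adjacent roots.
  set m : V → ℕ := fun w => min (D i w) (D j w) with hm
  have hg : ∀ r, L < r → x ^ (2 * r + 1) * ((L - r : ℕ) : ℝ) = 0 := fun r hr => by
    rw [Nat.sub_eq_zero_of_le (by omega)]; simp
  have hprod (w : V) (s : ℕ) : truncPow x L (D i w + s) * truncPow x L (D j w + s) =
      x ^ (2 * (m w + s) + 1) * ((L - (m w + s) : ℕ) : ℝ) -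
        q * (x ^ (2 * (m w + s + 1) + 1) * ((L - (m w + s + 1) : ℕ) : ℝ)) := by
    by_cases h : D i w ≤ L ∨ D j w ≤ L
    · rw [← truncPow_mul_succ hq]
      rcases hDij w h with h1 | h1
      · have : m w = D i w := by simp only [hm]; omega
        rw [this, ← h1, add_right_comm]
      · have : m w = D j w := by simp only [hm]; omega
        rw [this, ← h1, add_right_comm, mul_comm]
    · have : L < m w := by simp only [hm]; omega
      rw [truncPow_of_lt (by omega), Nat.sub_eq_zero_of_le (by omega),
        Nat.sub_eq_zero_of_le (by omega)]
      simp
  have hroot (w : V) : m w = 0 ↔ w = i ∨ w = j := by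
    have e1 := hzero i w
    have e2 := hzero j w
    have : m w = 0 ↔ D i w = 0 ∨ D j w = 0 := by simp only [hm]; omega
    rw [this, e1, e2, eq_comm, eq_comm (a := j)]
  -- the parent of a vertex towards the nearer root
  have hparent (a b w u : V) (hab : H.Adj a b) (hw : D a w ≤ L) (hlt : D a w + 1 = D b w)
      (hu : H.Adj w u) : min (D a u) (D b u) + 1 = D a w ↔ D a u + 1 = D a w := by
    have e1 := hlip w u b hu
    have e2 := hlip w u a hu
    omega
  have hDi (w : V) (h : m w ≤ L) : (m w = D i w ∧ D i w + 1 = D j w) ∨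
      (m w = D j w ∧ D j w + 1 = D i w) := by
    have := hDij w (by simp only [hm] at h; omega)
    simp only [hm]
    omega
  rw [treeGram_eq_sum_radial (g := fun r => x ^ (2 * r + 1) * ((L - r : ℕ) : ℝ)) hg
    (m := m) hprod, H.sum_radial m hg]
  · simp only [hroot]
    have hset : ({w | w = i ∨ w = j} : Finset V) = {i, j} := by
      ext w
      simp
    rw [hset, sum_pair hij.ne]
    have hi : #{u | H.Adj i u ∧ (u = i ∨ u = j)} = 1 := by
      refine card_eq_one.mpr ⟨j, ?_⟩
      ext u
      simp only [mem_filter, mem_univ, true_and, mem_singleton]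
      constructor
      · rintro ⟨h, rfl | rfl⟩
        · exact absurd h (H.irrefl)
        · rfl
      · rintro rfl
        exact ⟨hij, Or.inr rfl⟩
    have hj : #{u | H.Adj j u ∧ (u = i ∨ u = j)} = 1 := by
      refine card_eq_one.mpr ⟨i, ?_⟩
      ext u
      simp only [mem_filter, mem_univ, true_and, mem_singleton]
      constructor
      · rintro ⟨h, rfl | rfl⟩
        · rfl
        · exact absurd h (H.irrefl)
      · rintro rfl
        exact ⟨hij.symm, Or.inl rfl⟩
    rw [hi, hj]
    simp
    ring
  · intro w h0 hw
    rcases hDi w hw with ⟨h1, h2⟩ | ⟨h1, h2⟩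
    · rw [h1] at h0 hw ⊢
      refine (congrArg card ?_).trans (hH.card_parents (by omega) h0 hw)
      ext u
      simp only [mem_filter, mem_univ, true_and]
      exact and_congr_right fun hu => hparent i j w u hij hw h2 hu
    · rw [h1] at h0 hw ⊢
      refine (congrArg card ?_).trans (hH.card_parents (by omega) h0 hw)
      ext u
      simp only [mem_filter, mem_univ, true_and, hm]
      refine and_congr_right fun hu => ?_
      rw [min_comm]
      exact hparent j i w u hij.symm hw h2 hu
  · -- two adjacent vertices at the same distance from different ends of the root edge
    have hmixed : ∀ a b, H.Adj a b → ∀ u w, H.Adj u w → D a u + 1 = D b u → D b w + 1 = D a w →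
        D a u = D b w → D b w + 1 ≤ L → D b w = 0 := by
      intro a b hab u w huw h1 h2 h3 hL
      by_contra h0
      -- The parent `v` of `w` towards `b` is also a parent of `w` towards `a`, as is `u`.
      -- Uniqueness gives u = v, but their distances to `b` differ.
      obtain ⟨v, hv, hdv⟩ := hex b w (Nat.pos_of_ne_zero h0) (by omega)
      have e1 := hlip v w a hv.symm
      have e2 := hlip w v a hv
      have e3 := hne v w a hv.symm (by omega)
      have e4 := hlip a b v hab
      rw [hsymm v a, hsymm v b] at e4
      have : u = v := huniq a u v w huw.symm hv (by omega) (by omega) (by omega)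
      subst this
      omega
    intro u w huw heq hw
    have hne1 := hne u w i huw
    have hne2 := hne u w j huw
    rcases hDi u (by omega) with ⟨h1, h2⟩ | ⟨h1, h2⟩ <;>
      rcases hDi w (by omega) with ⟨h3, h4⟩ | ⟨h3, h4⟩
    · omega
    · rw [h3]
      exact hmixed i j hij u w huw h2 h4 (by omega) (by omega)
    · rw [h3]
      exact hmixed j i hij.symm u w huw h2 h4 (by omega) (by omega)
    · omega
  · intro u w huw
    have e1 := hlip u w i huw
    have e2 := hlip u w j huw
    simp only [hm]
    omega

end TreeGram

/-! ### Vector colourings of graphs without small dense spots. -/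

section VectorColoring

open Finset Classical

variable {V : Type*}

/-- The graph obtained from `G` by removing all edges that meet `S`. -/
def SimpleGraph.isolate (G : SimpleGraph V) (S : Finset V) : SimpleGraph V where
  Adj u v := G.Adj u v ∧ u ∉ S ∧ v ∉ S
  symm := ⟨fun _ _ h => ⟨h.1.symm, h.2.2, h.2.1⟩⟩
  loopless := ⟨fun _ h => G.irrefl h.1⟩

/-- No set of at most `M` vertices spans more edges than it has vertices. -/
def SimpleGraph.NearlySparse (G : SimpleGraph V) (M : ℕ) : Prop :=
  ∀ W : Finset V, #W ≤ M → #(G.edgesWithin W) ≤ #W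

/-- In a graph without small dense spots, some independent set meets all small cycles. -/
lemma SimpleGraph.NearlySparse.exists_independent [Fintype V] {G : SimpleGraph V} {M : ℕ}
    (hG : G.NearlySparse (2 * M)) :
    ∃ S : Finset V, (∀ u ∈ S, ∀ v ∈ S, ¬ G.Adj u v) ∧ (G.isolate S).LocallySparse M := by
  let Q : Finset V → Prop := fun S =>
    ∀ W, Disjoint W S → W.Nonempty → #W ≤ M → #(G.edgesWithin W) < #W
  have hQ : Q univ := fun W hW hne => by
    obtain ⟨w, hw⟩ := hne
    exact absurd (mem_univ w) (Finset.disjoint_left.mp hW hw)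
  -- Take `S` of minimum size. Then each `x` in `S` has a small witness `W` that meets `S` only in
  -- `x` and spans at least #W edges.
  obtain ⟨S, hS, hmin⟩ := exists_min_image (univ.filter Q) card ⟨univ, by simp [hQ]⟩
  rw [mem_filter] at hS
  refine ⟨S, fun u hu v hv huv => ?_, fun W hW hWM => ?_⟩
  · have hwit (x : V) (hx : x ∈ S) : ∃ W, x ∈ W ∧ Disjoint W (S.erase x) ∧ #W ≤ M ∧
        #W ≤ #(G.edgesWithin W) := by
      have : ¬ Q (S.erase x) := fun h => by
        have h1 := hmin (S.erase x) (by simp [h])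
        have h2 := card_erase_lt_of_mem hx
        omega
      simp only [Q] at this
      push Not at this
      obtain ⟨W, hdisj, hne, hWM, hle⟩ := this
      refine ⟨W, ?_, hdisj, hWM, hle⟩
      by_contra hxW
      refine absurd (hS.2 W ?_ hne hWM) (by omega)
      rw [Finset.disjoint_left] at hdisj ⊢
      intro y hy hyS
      exact hdisj hy (mem_erase.mpr ⟨fun h => hxW (h ▸ hy), hyS⟩)
    obtain ⟨A, huA, hdA, hAM, hA⟩ := hwit u hu
    obtain ⟨B, hvB, hdB, hBM, hB⟩ := hwit v hv
    have hvA : v ∉ A := fun h => Finset.disjoint_left.mp hdA h (mem_erase.mpr ⟨huv.ne', hv⟩)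
    have huB : u ∉ B := fun h => Finset.disjoint_left.mp hdB h (mem_erase.mpr ⟨huv.ne, hu⟩)
    have hinter : #(G.edgesWithin A ∩ G.edgesWithin B) ≤ #(A ∩ B) := by
      have h1 : G.edgesWithin A ∩ G.edgesWithin B ⊆ G.edgesWithin (A ∩ B) := by
        intro e
        induction e with
        | _ x y =>
          simp only [mem_inter, mk_mem_edgesWithin]
          tauto
      refine (card_le_card h1).trans ?_
      rcases (A ∩ B).eq_empty_or_nonempty with h0 | h0
      · rw [h0]
        simp [edgesWithin]
      · refine (hS.2 _ ?_ h0 ((card_le_card inter_subset_left).trans hAM)).le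
        rw [Finset.disjoint_left]
        intro x hx hxS
        rw [mem_inter] at hx
        by_cases hxu : x = u
        · exact huB (hxu ▸ hx.2)
        · exact Finset.disjoint_left.mp hdA hx.1 (mem_erase.mpr ⟨hxu, hxS⟩)
    have hsub : insert s(u, v) (G.edgesWithin A ∪ G.edgesWithin B) ⊆ G.edgesWithin (A ∪ B) := by
      intro e
      induction e with
      | _ x y =>
        simp only [mem_insert, mem_union, mk_mem_edgesWithin]
        rintro (h | h | h)
        · rcases Sym2.eq_iff.mp h with ⟨rfl, rfl⟩ | ⟨rfl, rfl⟩
          · exact ⟨⟨Or.inl huA, Or.inr hvB⟩, huv⟩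
          · exact ⟨⟨Or.inr hvB, Or.inl huA⟩, huv.symm⟩
        · tauto
        · tauto
    -- The edge `uv` lies inside neither witness, so A ∪ B spans at least #A + #B - #(A ∩ B) + 1
    -- edges, one more than it has vertices.
    have hnot : s(u, v) ∉ G.edgesWithin A ∪ G.edgesWithin B := by
      simp only [mem_union, mk_mem_edgesWithin]
      tauto
    have h1 := card_le_card hsub
    rw [card_insert_of_notMem hnot] at h1
    have h2 := card_union_add_card_inter (G.edgesWithin A) (G.edgesWithin B)
    have h3 := card_union_add_card_inter A B
    have h4 := hG (A ∪ B) ((card_union_le _ _).trans (by omega))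
    omega
  · have hsub : (G.isolate S).edgesWithin W ⊆ G.edgesWithin (W \ S) := by
      intro e
      induction e with
      | _ x y =>
        simp only [mk_mem_edgesWithin, Finset.mem_sdiff]
        rintro ⟨⟨h1, h2⟩, h3, h4, h5⟩
        exact ⟨⟨⟨h1, h4⟩, h2, h5⟩, h3⟩
    refine lt_of_le_of_lt (card_le_card hsub) ?_
    rcases (W \ S).eq_empty_or_nonempty with h0 | h0
    · rw [h0]
      simpa [edgesWithin] using hW
    · have h1 : #(W \ S) ≤ #W := card_le_card sdiff_subset
      exact lt_of_lt_of_le (hS.2 _ sdiff_disjoint h0 (h1.trans hWM)) h1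

/-- A vector colouring of `G` from one of the graph obtained by isolating an independent set. -/
lemma SimpleGraph.exists_vectorColoring_of_isolate [Fintype V] {G : SimpleGraph V} {d L : ℕ}
    {ρ y : ℝ} (hdeg : ∀ v, G.degree v ≤ d) {S : Finset V} (hd : 1 ≤ d)
    (hS : ∀ u ∈ S, ∀ v ∈ S, ¬ G.Adj u v) (hH : (G.isolate S).LocallySparse (2 * L + 2))
    (hL : 0 < L) (hy : 0 < y) (hqy : ((d : ℝ) - 1) * y ^ 2 = 1) (hρ0 : 0 ≤ ρ)
    (hρ : ρ * (L + 1 + y ^ 2 * L) ≤ (1 - ρ) * (2 * y * L)) :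
    ∃ P : V → V → ℝ, (∀ i j, P i j = P j i) ∧ (∀ i, P i i = 1) ∧
      (∀ x : V → ℝ, 0 ≤ ∑ i, ∑ j, P i j * (x i * x j)) ∧ ∀ i j, G.Adj i j → P i j = -ρ := by
  -- The negative base makes adjacent vertices negatively correlated.
  set T := treeGram (G.isolate S) ((d : ℝ) - 1) (-y) L with hT
  have hqx : ((d : ℝ) - 1) * (-y) ^ 2 = 1 := by rw [neg_sq]; exact hqy
  have hTself (i : V) : T i i = L + 1 + y ^ 2 * L := by
    rw [hT, treeGram_self hH hqx, neg_sq]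
  have hTadj (i j : V) (hij : (G.isolate S).Adj i j) : T i j = -(2 * y * L) := by
    rw [hT, treeGram_of_adj hH hqx hij]
    ring
  have hTpsd (x : V → ℝ) : 0 ≤ ∑ i, ∑ j, T i j * (x i * x j) := by
    refine treeGram_psd ?_ (fun w => ?_) x
    · rw [sub_nonneg]; exact_mod_cast hd
    · rw [sub_add_cancel]
      have : (G.isolate S).degree w ≤ G.degree w := by
        refine degree_le_of_le ?_
        exact fun _ _ h => h.1
      exact_mod_cast this.trans (hdeg w)
  have hyL : 0 < 2 * y * L := by positivity
  -- `α` is chosen so that an edge off `S` receives ρ² - ρ(1 + ρ) = -ρ, and `β` then fills the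
  -- diagonal up to 1; `hρ` says exactly that there is room for it.
  set α := ρ * (1 + ρ) / (2 * y * L) with hα
  have hα0 : 0 ≤ α := by positivity
  have hαL : α * (2 * y * L) = ρ * (1 + ρ) := div_mul_cancel₀ _ hyL.ne'
  set β := 1 - ρ ^ 2 - α * (L + 1 + y ^ 2 * L) with hβ
  have hβ0 : 0 ≤ β := by
    have h1 : α * (L + 1 + y ^ 2 * L) ≤ (1 + ρ) * (1 - ρ) := by
      rw [hα, div_mul_eq_mul_div, div_le_iff₀ hyL]
      nlinarith [mul_le_mul_of_nonneg_left hρ (show 0 ≤ 1 + ρ by linarith)]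
    rw [hβ]
    linarith
  -- All of `S` shares one unit vector, and every other vertex has component -ρ along it.
  set z : V → ℝ := fun i => if i ∈ S then 1 else -ρ with hz
  set b : V → ℝ := fun i => if i ∈ S then 0 else 1 with hb
  refine ⟨fun i j => z i * z j + b i * b j * (α * T i j + if i = j then β else 0),
    fun i j => ?_, fun i => ?_, fun x => ?_, fun i j hij => ?_⟩
  · simp only [hT, treeGram_comm i j, eq_comm (a := i)]
    ring
  · by_cases hi : i ∈ S
    · simp [hz, hb, hi]
    · simp only [hz, hb, hi, if_false, if_true, hTself, hβ]
      ring
  · have h : ∑ i, ∑ j, (z i * z j + b i * b j * (α * T i j + if i = j then β else 0)) *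
        (x i * x j) = ∑ i, ∑ j, z i * z j * (x i * x j) +
        α * ∑ i, ∑ j, T i j * ((b i * x i) * (b j * x j)) + ∑ i, β * (b i * x i) ^ 2 := by
      rw [mul_sum, ← sum_add_distrib, ← sum_add_distrib]
      refine sum_congr rfl fun i _ => ?_
      have h1 : β * (b i * x i) ^ 2 =
          ∑ j, if i = j then β * ((b i * x i) * (b j * x j)) else 0 := by
        rw [sum_ite_eq univ i, if_pos (mem_univ _)]
        ring
      rw [h1, mul_sum, ← sum_add_distrib, ← sum_add_distrib]
      refine sum_congr rfl fun j _ => ?_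
      split_ifs <;> ring
    change 0 ≤ ∑ i, ∑ j, (z i * z j + b i * b j * (α * T i j + if i = j then β else 0)) *
        (x i * x j)
    rw [h]
    refine add_nonneg (add_nonneg (sum_sum_mul_mul_nonneg _ _) (mul_nonneg hα0 (hTpsd _))) ?_
    exact sum_nonneg fun i _ => mul_nonneg hβ0 (sq_nonneg _)
  · by_cases hi : i ∈ S
    · have hj : j ∉ S := fun hj => hS i hi j hj hij
      simp [hz, hb, hi, hj]
    · by_cases hj : j ∈ S
      · simp [hz, hb, hi, hj]
      · simp only [hz, hb, hi, hj, if_false, hij.ne, hTadj i j ⟨hij, hi, hj⟩]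
        linear_combination -hαL

/-- Above the threshold, graphs of maximum degree `d` without small dense spots have vector
`κ`-colourings. -/
lemma SimpleGraph.exists_vectorColoring_of_nearlySparse {d : ℕ} (hd : 2 ≤ d) {κ : ℝ}
    (hκ : κ > 2 + (d : ℝ) / (2 * Real.sqrt ((d : ℝ) - 1))) :
    ∃ M : ℕ, ∀ {V : Type*} [Fintype V] (G : SimpleGraph V), (∀ v, G.degree v ≤ d) →
      G.NearlySparse M →
      ∃ P : V → V → ℝ, (∀ i j, P i j = P j i) ∧ (∀ i, P i i = 1) ∧
        (∀ x : V → ℝ, 0 ≤ ∑ i, ∑ j, P i j * (x i * x j)) ∧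
        ∀ i j, G.Adj i j → P i j = -(1 / (κ - 1)) := by
  have hd' : (2 : ℝ) ≤ d := by exact_mod_cast hd
  have hq : (0 : ℝ) < (d : ℝ) - 1 := by linarith
  set w := Real.sqrt ((d : ℝ) - 1) with hw
  have hw0 : 0 < w := Real.sqrt_pos.mpr hq
  have hww : w ^ 2 = (d : ℝ) - 1 := Real.sq_sqrt hq.le
  have hfrac : 0 < (d : ℝ) / (2 * w) := by positivity
  have hκ2 : (d : ℝ) < (κ - 2) * (2 * w) := by
    rw [← div_lt_iff₀ (by positivity)]
    linarith
  have hκ1 : 0 < κ - 1 := by linarith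
  -- With y = 1/w and ρ = 1/(κ - 1), the condition on `L` reads 1 ≤ L · slope, and positivity of the
  -- slope is the threshold condition.
  have hslope : 0 < (κ - 2) * (2 * w⁻¹) - (1 + w⁻¹ ^ 2) := by
    have : (κ - 2) * (2 * w⁻¹) - (1 + w⁻¹ ^ 2) = ((κ - 2) * (2 * w) - d) / w ^ 2 := by
      have : (d : ℝ) = w ^ 2 + 1 := by linarith
      rw [this]
      field_simp
    rw [this]
    exact div_pos (by linarith) (by positivity)
  obtain ⟨L, hL⟩ := exists_nat_gt (1 / ((κ - 2) * (2 * w⁻¹) - (1 + w⁻¹ ^ 2)))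
  rw [div_lt_iff₀ hslope] at hL
  have hL0 : 0 < L := by
    rcases Nat.eq_zero_or_pos L with h | h
    · rw [h] at hL
      norm_num at hL
    · exact h
  -- Local sparsity is needed up to 2L + 2 vertices; the outer factor 2 allows for the union of two
  -- witnesses.
  refine ⟨2 * (2 * L + 2), fun {V} _ G hdeg hG => ?_⟩
  obtain ⟨S, hS, hH⟩ := hG.exists_independent
  refine exists_vectorColoring_of_isolate hdeg (by omega) hS hH hL0 (inv_pos.mpr hw0) ?_
    (by positivity) ?_
  · rw [← hww, ← mul_pow, mul_inv_cancel₀ hw0.ne', one_pow]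
  · have : 1 - 1 / (κ - 1) = 1 / (κ - 1) * (κ - 2) := by
      field_simp
      ring
    rw [this, mul_assoc]
    refine mul_le_mul_of_nonneg_left ?_ (by positivity)
    linarith

end VectorColoring

/-! ### Existence of regular graphs, so that the probabilities are not 0/0. -/

section RegularExistence

open Finset Classical

lemma mem_regularGraphs {n d : ℕ} {G : SimpleGraph (Fin n)} :
    G ∈ regularGraphs n d ↔ ∀ v, #{w | G.Adj v w} = d := by
  have h (v : Fin n) : #{w | G.Adj v w} = G.degree v := by
    rw [← G.card_neighborFinset_eq_degree, G.neighborFinset_eq_filter]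
  simp only [h]
  rfl

/-- The circulant graph with connection set {±1, …, ±a}; the bound on `a` keeps these residues
distinct. -/
lemma exists_regularGraph_of_even {m a : ℕ} (h : 2 * a < m + 1) :
    ∃ G : SimpleGraph (Fin (m + 1)), G ∈ regularGraphs (m + 1) (2 * a) := by
  let S : Finset (Fin (m + 1)) := {x | (1 ≤ x.val ∧ x.val ≤ a) ∨ m + 1 - a ≤ x.val}
  have hneg (x : Fin (m + 1)) : -x ∈ S ↔ x ∈ S := by
    simp only [S, mem_filter, mem_univ, true_and, Fin.val_neg']
    have hx := x.isLt
    rcases Nat.eq_zero_or_pos x.val with h0 | h0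
    · simp [h0]
    · rw [Nat.mod_eq_of_lt (by omega)]
      omega
  have h0 : (0 : Fin (m + 1)) ∉ S := by
    simp only [S, mem_filter, mem_univ, true_and, Fin.val_zero]
    omega
  have hcard : #S = 2 * a := by
    rw [← card_image_of_injective S Fin.val_injective]
    have himg : S.image Fin.val = Icc 1 a ∪ Ico (m + 1 - a) (m + 1) := by
      ext t
      simp only [S, mem_image, mem_filter, mem_univ, true_and, mem_union, mem_Icc, mem_Ico]
      constructor
      · rintro ⟨x, hx, rfl⟩
        have := x.isLt
        omega
      · intro ht
        exact ⟨⟨t, by omega⟩, by dsimp only; omega, rfl⟩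
    rw [himg, card_union_of_disjoint]
    · simp only [Nat.card_Icc, Nat.card_Ico]
      omega
    · rw [Finset.disjoint_left]
      intro t ht ht'
      rw [mem_Icc] at ht
      rw [mem_Ico] at ht'
      omega
  refine ⟨SimpleGraph.circulantGraph (S : Set (Fin (m + 1))), mem_regularGraphs.mpr fun v => ?_⟩
  rw [← hcard, ← card_image_of_injective S (add_right_injective v)]
  congr 1
  ext w
  simp only [SimpleGraph.circulantGraph_adj, mem_coe, mem_filter, mem_univ, true_and, mem_image]
  have hvw : v - w ∈ S ↔ w - v ∈ S := by rw [← hneg, neg_sub]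
  rw [hvw, or_self]
  constructor
  · rintro ⟨-, hw⟩
    exact ⟨w - v, hw, by abel⟩
  · rintro ⟨s, hs, rfl⟩
    refine ⟨fun h => h0 ?_, by simpa using hs⟩
    have : s = 0 := by simpa using h
    exact this ▸ hs

/-- If `d` is odd then `n` is even, so n - 1 - d is even and the complement of a circulant graph
works. -/
lemma regularGraphs_nonempty {n d : ℕ} (hdn : d < n) (h : Even (n * d)) :
    (regularGraphs n d).Nonempty := by
  obtain ⟨m, rfl⟩ : ∃ m, n = m + 1 := ⟨n - 1, by omega⟩
  rcases Nat.even_or_odd d with hd | hd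
  · obtain ⟨a, ha⟩ := hd
    obtain ⟨G, hG⟩ := exists_regularGraph_of_even (m := m) (a := a) (by omega)
    exact ⟨G, by rwa [show d = 2 * a by omega]⟩
  · have hn : Even (m + 1) := by
      rcases Nat.even_mul.mp h with h | h
      · exact h
      · exact absurd h (Nat.not_even_iff_odd.mpr hd)
    obtain ⟨b, hb⟩ := hn
    obtain ⟨a, ha⟩ := hd
    obtain ⟨G, hG⟩ := exists_regularGraph_of_even (m := m) (a := b - 1 - a) (by omega)
    refine ⟨Gᶜ, ?_⟩
    have h1 : G.IsRegularOfDegree (2 * (b - 1 - a)) := hG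
    have h2 := h1.compl
    rw [Fintype.card_fin, show m + 1 - 1 - 2 * (b - 1 - a) = d by omega] at h2
    rw [mem_regularGraphs]
    intro v
    rw [← h2.degree_eq v, ← SimpleGraph.card_neighborFinset_eq_degree]
    congr 1
    ext w
    simp

end RegularExistence

/-! ### Switchings bound the probability of containing given edges. -/

section Switching

open Finset Classical

variable {V : Type*}

/-- Replace the edges `uv` and `xy` by `ux` and `vy`. -/
def SimpleGraph.switch (G : SimpleGraph V) (u v x y : V) : SimpleGraph V :=
  SimpleGraph.fromEdgeSet ((G.edgeSet \ {s(u, v), s(x, y)}) ∪ {s(u, x), s(v, y)})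

/-- The edge `xy` can be switched with the edge `uv`. -/
structure SimpleGraph.Switchable (G : SimpleGraph V) (u v x y : V) : Prop where
  adj : G.Adj x y
  ne_left : x ≠ u
  ne_right : x ≠ v
  ne_left' : y ≠ u
  ne_right' : y ≠ v
  not_adj : ¬ G.Adj u x
  not_adj' : ¬ G.Adj v y

namespace SimpleGraph

variable {G : SimpleGraph V} {u v x y : V}

lemma switch_adj {a b : V} : (G.switch u v x y).Adj a b ↔
    ((G.Adj a b ∧ s(a, b) ≠ s(u, v) ∧ s(a, b) ≠ s(x, y)) ∨
      s(a, b) = s(u, x) ∨ s(a, b) = s(v, y)) ∧ a ≠ b := by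
  simp only [switch, fromEdgeSet_adj, Set.mem_union, Set.mem_sdiff, mem_edgeSet,
    Set.mem_insert_iff, Set.mem_singleton_iff, not_or]

/-- A switch is undone by another switch, so for fixed vertices it is injective. -/
lemma Switchable.switch_switch (h : G.Switchable u v x y) (huv : G.Adj u v) :
    (G.switch u v x y).switch u x v y = G := by
  obtain ⟨h1, h2, h3, h4, h5, h6, h7⟩ := h
  have hne := huv.ne
  have hne' := h1.ne
  ext a b
  simp only [switch_adj]
  have hab : G.Adj a b → a ≠ b := fun h => h.ne
  have e1 : s(a, b) = s(u, v) → G.Adj a b := fun h => by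
    rw [← mem_edgeSet, h]; exact huv
  have e2 : s(a, b) = s(x, y) → G.Adj a b := fun h => by
    rw [← mem_edgeSet, h]; exact h1
  have e3 : s(a, b) = s(u, x) → ¬ G.Adj a b := fun h => by
    rw [← mem_edgeSet, h]; exact h6
  have e4 : s(a, b) = s(v, y) → ¬ G.Adj a b := fun h => by
    rw [← mem_edgeSet, h]; exact h7
  tauto

lemma card_insert_erase {α : Type*} {s : Finset α} {a b : α} (ha : a ∈ s) (hb : b ∉ s) :
    #(insert b (s.erase a)) = #s := by
  rw [card_insert_of_notMem (fun h => hb (mem_of_mem_erase h)), card_erase_add_one ha]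

/-- Each of the four vertices trades one neighbour for another, and all other neighbourhoods are
unchanged. -/
lemma Switchable.card_neighbors_switch [Fintype V] (h : G.Switchable u v x y) (huv : G.Adj u v)
    (w : V) : #{z | (G.switch u v x y).Adj w z} = #{z | G.Adj w z} := by
  obtain ⟨h1, h2, h3, h4, h5, h6, h7⟩ := h
  have hne := huv.ne
  have hne' := h1.ne
  have hvu := huv.symm
  have hyx := h1.symm
  have h6' : ¬ G.Adj x u := fun h => h6 h.symm
  have h7' : ¬ G.Adj y v := fun h => h7 h.symm
  have key (p q : V) (hp : G.Adj w p) (hq : ¬ G.Adj w q)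
      (hz : ∀ z, (G.switch u v x y).Adj w z ↔ z = q ∨ (z ≠ p ∧ G.Adj w z)) :
      #{z | (G.switch u v x y).Adj w z} = #{z | G.Adj w z} := by
    rw [← card_insert_erase (s := ({z | G.Adj w z} : Finset V)) (a := p) (b := q) (by simpa)
      (by simpa)]
    congr 1
    ext z
    simp [hz]
  have hloop (z : V) : G.Adj w z → w ≠ z := fun h => h.ne
  by_cases hwu : w = u
  · subst hwu
    refine key v x huv h6 fun z => ?_
    simp only [switch_adj, Sym2.eq_iff]
    grind
  by_cases hwv : w = v
  · subst hwv
    refine key u y hvu h7 fun z => ?_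
    simp only [switch_adj, Sym2.eq_iff]
    grind
  by_cases hwx : w = x
  · subst hwx
    refine key y u h1 h6' fun z => ?_
    simp only [switch_adj, Sym2.eq_iff]
    grind
  by_cases hwy : w = y
  · subst hwy
    refine key x v hyx h7' fun z => ?_
    simp only [switch_adj, Sym2.eq_iff]
    grind
  congr 1
  ext z
  simp only [switch_adj, Sym2.eq_iff, mem_filter, mem_univ, true_and]
  grind

/-- Most edges of a regular graph can be switched with a given edge while keeping `F`. -/
lemma card_switchable [Fintype V] {d : ℕ} (hG : ∀ w, #{z | G.Adj w z} = d) (u v : V)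
    (F : Finset (Sym2 V)) :
    Fintype.card V * d ≤ #{p : V × V | G.Switchable u v p.1 p.2 ∧ s(p.1, p.2) ∉ F} +
      (2 * (d + 2) + 2 * #F) * d := by
  have hfst (B : Finset V) : #{p : V × V | p.1 ∈ B ∧ G.Adj p.1 p.2} = #B * d := by
    have h (a : V) : (∑ b, if a ∈ B ∧ G.Adj a b then 1 else 0) = if a ∈ B then d else 0 := by
      by_cases ha : a ∈ B
      · simp only [ha, true_and, if_true]
        rw [← card_filter, hG]
      · simp [ha]
    rw [card_filter, Fintype.sum_prod_type]
    simp only [h, sum_ite_mem, univ_inter, sum_const, smul_eq_mul]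
  have hsnd (B : Finset V) : #{p : V × V | p.2 ∈ B ∧ G.Adj p.1 p.2} = #B * d := by
    rw [← hfst B]
    refine card_bij' (fun p _ => p.swap) (fun p _ => p.swap) ?_ ?_ ?_ ?_ <;>
      simp +contextual [G.adj_comm]
  have hall : #{p : V × V | G.Adj p.1 p.2} = Fintype.card V * d := by
    have := hfst univ
    simpa using this
  -- An ordered edge `(x, y)` can fail only if `x` is in `B₁` or `y` is in `B₂`, and each vertex of
  -- these sets spoils `d` ordered edges.
  let B₁ : Finset V := ({u, v} ∪ ({z | G.Adj u z} : Finset V)) ∪ F.biUnion Sym2.toFinset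
  let B₂ : Finset V := {u, v} ∪ ({z | G.Adj v z} : Finset V)
  have hB₂ : #B₂ ≤ d + 2 := by
    refine (card_union_le _ _).trans ?_
    rw [hG]
    have := card_le_two (a := u) (b := v)
    omega
  have hB₁ : #B₁ ≤ (d + 2) + 2 * #F := by
    refine (card_union_le _ _).trans (add_le_add ((card_union_le _ _).trans ?_) ?_)
    · rw [hG]
      have := card_le_two (a := u) (b := v)
      omega
    · refine card_biUnion_le.trans ((sum_le_card_nsmul _ _ 2 fun e _ => ?_).trans ?_)
      · rw [Sym2.card_toFinset]
        split_ifs <;> omega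
      · rw [smul_eq_mul, mul_comm]
  have hcover : ({p : V × V | G.Adj p.1 p.2} : Finset (V × V)) ⊆
      ({p : V × V | G.Switchable u v p.1 p.2 ∧ s(p.1, p.2) ∉ F} : Finset (V × V)) ∪
        (({p : V × V | p.1 ∈ B₁ ∧ G.Adj p.1 p.2} : Finset (V × V)) ∪
          ({p : V × V | p.2 ∈ B₂ ∧ G.Adj p.1 p.2} : Finset (V × V))) := by
    rintro ⟨x, y⟩ hp
    simp only [mem_filter, mem_univ, true_and] at hp
    simp only [mem_union, mem_filter, mem_univ, true_and, hp, and_true]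
    by_cases h1 : x ∈ B₁
    · exact Or.inr (Or.inl h1)
    by_cases h2 : y ∈ B₂
    · exact Or.inr (Or.inr h2)
    left
    simp only [B₁, B₂, mem_union, mem_insert, mem_singleton, mem_filter, mem_univ, true_and,
      mem_biUnion, not_or, not_exists, not_and, Sym2.mem_toFinset] at h1 h2
    refine ⟨⟨hp, h1.1.1.1, h1.1.1.2, h2.1.1, h2.1.2, h1.1.2, h2.2⟩, fun hF => ?_⟩
    exact h1.2 _ hF (Sym2.mem_mk_left _ _)
  have h := (card_le_card hcover).trans
    ((card_union_le _ _).trans (Nat.add_le_add_left (card_union_le _ _) _))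
  rw [hall, hfst, hsnd] at h
  refine h.trans (Nat.add_le_add_left ?_ _)
  rw [← add_mul]
  exact Nat.mul_le_mul_right _ (by omega)

/-- The `d`-regular graphs on `V` that contain all edges in `F`. -/
def regularContaining (V : Type*) [Fintype V] (d : ℕ) (F : Finset (Sym2 V)) :
    Finset (SimpleGraph V) :=
  {G | (∀ v, #{w | G.Adj v w} = d) ∧ (F : Set (Sym2 V)) ⊆ G.edgeSet}

/-- Double counting of switchings that remove `e` = `uv` and keep `F`. A graph containing `e` admits
at least nd/2 of them, while a resulting graph arises from at most d², because `x` and `y` are then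
neighbours of `u` and `v`. The ratio is 2d/n. -/
lemma card_regularContaining_insert [Fintype V] {d : ℕ} {F : Finset (Sym2 V)} {e : Sym2 V}
    (he : e ∉ F) (hn : 4 * (d + 2) + 4 * #F ≤ Fintype.card V) (hd : 0 < d) :
    #(regularContaining V d (insert e F)) * Fintype.card V ≤
      2 * d * #(regularContaining V d F) := by
  induction e with
  | _ u v =>
  set X := regularContaining V d (insert s(u, v) F) with hX
  set Y := regularContaining V d F with hY
  have hXmem (G : SimpleGraph V) (hG : G ∈ X) : (∀ v, #{w | G.Adj v w} = d) ∧ G.Adj u v ∧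
      (F : Set (Sym2 V)) ⊆ G.edgeSet := by
    simp only [hX, regularContaining, mem_filter, mem_univ, true_and, coe_insert,
      Set.insert_subset_iff, mem_edgeSet] at hG
    exact hG
  let A : SimpleGraph V → Finset (V × V) :=
    fun G => {p : V × V | G.Switchable u v p.1 p.2 ∧ s(p.1, p.2) ∉ F}
  let B : SimpleGraph V → Finset (V × V) := fun G =>
    ({z | G.Adj u z} : Finset V) ×ˢ ({z | G.Adj v z} : Finset V)
  have hle : #(X.sigma A) ≤ #(Y.sigma B) := by
    refine card_le_card_of_injOn (fun t => ⟨t.1.switch u v t.2.1 t.2.2, t.2⟩) ?_ ?_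
    · rintro ⟨G, x, y⟩ ht
      simp only [coe_sigma, Set.mem_sigma_iff, mem_coe, A, mem_filter, mem_univ, true_and] at ht
      obtain ⟨hG, hs, hF⟩ := ht
      obtain ⟨hreg, huv, hsub⟩ := hXmem G hG
      simp only [coe_sigma, Set.mem_sigma_iff, mem_coe, hY, regularContaining, B, mem_product,
        mem_filter, mem_univ, true_and]
      refine ⟨⟨fun w => ?_, fun f hf => ?_⟩, ?_, ?_⟩
      · rw [hs.card_neighbors_switch huv, hreg]
      · have hf' := hsub hf
        induction f with
        | _ a b =>
          refine switch_adj.mpr ⟨Or.inl ⟨hf', fun h => he (h ▸ hf), fun h => hF (h ▸ hf)⟩, ?_⟩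
          exact SimpleGraph.Adj.ne hf'
      · exact switch_adj.mpr ⟨Or.inr (Or.inl rfl), hs.ne_left.symm⟩
      · exact switch_adj.mpr ⟨Or.inr (Or.inr rfl), hs.ne_right'.symm⟩
    · rintro ⟨G, x, y⟩ ht ⟨G', x', y'⟩ ht' heq
      simp only [coe_sigma, Set.mem_sigma_iff, mem_coe, A, mem_filter, mem_univ, true_and] at ht ht'
      simp only [Sigma.mk.injEq, heq_eq_eq, Prod.mk.injEq] at heq
      obtain ⟨h1, rfl, rfl⟩ := heq
      have h2 := ht.2.1.switch_switch (hXmem G ht.1).2.1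
      rw [h1, ht'.2.1.switch_switch (hXmem G' ht'.1).2.1] at h2
      rw [h2]
  rw [card_sigma, card_sigma] at hle
  have hB : ∑ G ∈ Y, #(B G) = #Y * (d * d) := by
    rw [← smul_eq_mul, ← sum_const]
    refine sum_congr rfl fun G hG => ?_
    simp only [hY, regularContaining, mem_filter, mem_univ, true_and] at hG
    rw [card_product, hG.1, hG.1]
  have hA : ∀ G ∈ X, Fintype.card V * d ≤ 2 * #(A G) := by
    intro G hG
    have h1 := card_switchable (hXmem G hG).1 u v F
    have h2 : 2 * ((2 * (d + 2) + 2 * #F) * d) ≤ Fintype.card V * d := by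
      rw [← mul_assoc]
      exact Nat.mul_le_mul_right _ (by omega)
    simp only [A]
    omega
  have h1 : #X * (Fintype.card V * d) ≤ 2 * (#Y * (d * d)) := by
    calc #X * (Fintype.card V * d) = ∑ G ∈ X, Fintype.card V * d := by simp
      _ ≤ ∑ G ∈ X, 2 * #(A G) := sum_le_sum hA
      _ = 2 * ∑ G ∈ X, #(A G) := by rw [mul_sum]
      _ ≤ 2 * (#Y * (d * d)) := by rw [← hB]; exact Nat.mul_le_mul_left _ hle
  refine Nat.le_of_mul_le_mul_right ?_ hd
  calc _ = #X * (Fintype.card V * d) := by ring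
    _ ≤ _ := h1
    _ = _ := by ring

/-- A fixed set of `f` edges appears in a random regular graph with probability
`O(n ^ (-f))`. -/
lemma card_regularContaining_mul_pow_le [Fintype V] {d : ℕ} (hd : 0 < d) (F : Finset (Sym2 V))
    (hn : 4 * (d + 2) + 4 * #F ≤ Fintype.card V) :
    #(regularContaining V d F) * Fintype.card V ^ #F ≤
      (2 * d) ^ #F * #(regularContaining V d ∅) := by
  induction F using Finset.induction_on with
  | empty => simp
  | insert e F he ih =>
    rw [card_insert_of_notMem he] at hn ⊢
    have h1 := card_regularContaining_insert he (by omega) hd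
    have h2 := ih (by omega)
    calc _ = #(regularContaining V d (insert e F)) * Fintype.card V * Fintype.card V ^ #F := by
          ring
      _ ≤ 2 * d * #(regularContaining V d F) * Fintype.card V ^ #F :=
          Nat.mul_le_mul_right _ h1
      _ = 2 * d * (#(regularContaining V d F) * Fintype.card V ^ #F) := by ring
      _ ≤ 2 * d * ((2 * d) ^ #F * #(regularContaining V d ∅)) := Nat.mul_le_mul_left _ h2
      _ = _ := by ring

end SimpleGraph

end Switching

/-! ### Union bound over small dense spots, and transfer to high probability. -/

section UnionBound

open Finset Classical

/-- The constant in the bound for the probability that a random `d`-regular graph has a small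
dense spot. -/
def denseConst (d M : ℕ) : ℝ :=
  -- A set of w vertices has (w + 1).choose 2 unordered pairs, the diagonal of `Sym2` included.
  ∑ w ∈ range (M + 1), (((w + 1).choose 2).choose (w + 1) : ℝ) * (2 * d) ^ (w + 1)

/-- There are at most n^w vertex sets of size w, and each choice of w + 1 edges on one of them has
probability at most (2d/n)^(w+1). The one excess edge leaves a factor 1/n. -/
lemma card_not_nearlySparse_le {n d M : ℕ} (hd : 0 < d)
    (hn : 4 * (d + 2) + 4 * (M + 1) ≤ n) :
    (#{G ∈ SimpleGraph.regularContaining (Fin n) d ∅ | ¬ G.NearlySparse M} : ℝ) ≤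
      denseConst d M / n * #(SimpleGraph.regularContaining (Fin n) d ∅) := by
  set R := SimpleGraph.regularContaining (Fin n) d ∅ with hR
  have hn0 : (0 : ℝ) < n := by
    have : 0 < n := by omega
    exact_mod_cast this
  have hsub : ({G ∈ R | ¬ G.NearlySparse M} : Finset (SimpleGraph (Fin n))) ⊆
      (range (M + 1)).biUnion fun w => (powersetCard w (univ : Finset (Fin n))).biUnion fun W =>
        (powersetCard (w + 1) W.sym2).biUnion fun F =>
          SimpleGraph.regularContaining (Fin n) d F := by
    intro G hG
    rw [mem_filter] at hG
    obtain ⟨hGR, hG⟩ := hG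
    unfold SimpleGraph.NearlySparse at hG
    push Not at hG
    obtain ⟨W, hWM, hW⟩ := hG
    obtain ⟨F, hF, hFcard⟩ := exists_subset_card_eq (Nat.succ_le_of_lt hW)
    simp only [mem_biUnion, mem_range, mem_powersetCard]
    refine ⟨#W, by omega, W, ⟨subset_univ _, rfl⟩, F,
      ⟨fun e he => (mem_filter.mp (hF he)).1, hFcard⟩, ?_⟩
    simp only [hR, SimpleGraph.regularContaining, mem_filter, mem_univ, true_and] at hGR ⊢
    exact ⟨hGR.1, fun e he => (mem_filter.mp (hF he)).2⟩
  have hF (w : ℕ) (hw : w ∈ range (M + 1)) (W : Finset (Fin n))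
      (F : Finset (Sym2 (Fin n))) (hF : F ∈ powersetCard (w + 1) W.sym2) :
      (#(SimpleGraph.regularContaining (Fin n) d F) : ℝ) ≤
        (2 * d) ^ (w + 1) * #R / (n : ℝ) ^ (w + 1) := by
    rw [mem_range] at hw
    rw [mem_powersetCard] at hF
    have h := SimpleGraph.card_regularContaining_mul_pow_le hd F
      (by rw [Fintype.card_fin, hF.2]; omega)
    rw [Fintype.card_fin, hF.2] at h
    rw [le_div_iff₀ (by positivity)]
    exact_mod_cast h
  have hbound : (#{G ∈ R | ¬ G.NearlySparse M} : ℝ) ≤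
      ∑ w ∈ range (M + 1), ∑ W ∈ powersetCard w (univ : Finset (Fin n)),
        ∑ F ∈ powersetCard (w + 1) W.sym2,
          (#(SimpleGraph.regularContaining (Fin n) d F) : ℝ) := by
    have h1 := (card_le_card hsub).trans (card_biUnion_le.trans (sum_le_sum fun w _ =>
      card_biUnion_le.trans (sum_le_sum fun W _ => card_biUnion_le)))
    exact_mod_cast h1
  refine hbound.trans ?_
  rw [denseConst, sum_div, sum_mul]
  refine sum_le_sum fun w hw => ?_
  have hW (W : Finset (Fin n)) (hW : W ∈ powersetCard w (univ : Finset (Fin n))) :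
      ∑ F ∈ powersetCard (w + 1) W.sym2, (#(SimpleGraph.regularContaining (Fin n) d F) : ℝ) ≤
        (((w + 1).choose 2).choose (w + 1) : ℝ) *
          ((2 * d) ^ (w + 1) * #R / (n : ℝ) ^ (w + 1)) := by
    refine (sum_le_card_nsmul _ _ _ fun F hF' => hF w hw W F hF').trans ?_
    rw [card_powersetCard, card_sym2, (mem_powersetCard.mp hW).2, nsmul_eq_mul]
  refine (sum_le_card_nsmul _ _ _ hW).trans ?_
  rw [card_powersetCard, card_univ, Fintype.card_fin, nsmul_eq_mul]
  have hch : (n.choose w : ℝ) ≤ (n : ℝ) ^ w := by exact_mod_cast Nat.choose_le_pow n w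
  refine (mul_le_mul_of_nonneg_right hch (by positivity)).trans (le_of_eq ?_)
  field_simp
  ring

lemma coe_regularContaining_empty (n d : ℕ) :
    (SimpleGraph.regularContaining (Fin n) d ∅ : Set (SimpleGraph (Fin n))) =
      regularGraphs n d := by
  ext G
  simp [SimpleGraph.regularContaining, mem_regularGraphs]

/-- Random regular graphs have no small dense spots, so whatever this implies holds with high
probability. -/
lemma regularWHP_of_nearlySparse {d M : ℕ} (hd : 0 < d)
    {P : ∀ n : ℕ, SimpleGraph (Fin n) → Prop}
    (hP : ∀ n, 0 < n → ∀ G ∈ regularGraphs n d, G.NearlySparse M → P n G) : RegularWHP d P := by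
  have hlim : Tendsto (fun n : ℕ => 1 - denseConst d M / n) (atTop ⊓ 𝓟 {n : ℕ | Even (n * d)})
      (𝓝 1) := by
    have h : Tendsto (fun n : ℕ => 1 - denseConst d M / n) atTop (𝓝 (1 - 0)) :=
      tendsto_const_nhds.sub (tendsto_const_div_atTop_nhds_zero_nat _)
    rw [sub_zero] at h
    exact h.mono_left inf_le_left
  refine tendsto_of_tendsto_of_tendsto_of_le_of_le' hlim tendsto_const_nhds ?_ ?_
  · rw [eventually_inf_principal]
    filter_upwards [eventually_ge_atTop (4 * (d + 2) + 4 * (M + 1))] with n hn heven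
    set R := SimpleGraph.regularContaining (Fin n) d ∅ with hR
    have hRc : (regularGraphs n d).ncard = #R := by
      rw [← coe_regularContaining_empty, Set.ncard_coe_finset]
    have hR0 : (0 : ℝ) < #R := by
      have : 0 < #R := by
        rw [← hRc, Set.ncard_pos (Set.toFinite _)]
        exact regularGraphs_nonempty (by omega) heven
      exact_mod_cast this
    have hgood : #{G ∈ R | G.NearlySparse M} ≤ {G ∈ regularGraphs n d | P n G}.ncard := by
      rw [← Set.ncard_coe_finset]
      refine Set.ncard_le_ncard ?_ (Set.toFinite _)
      intro G hG
      rw [mem_coe, mem_filter, ← mem_coe, coe_regularContaining_empty] at hG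
      exact ⟨hG.1, hP n (by omega) G hG.1 hG.2⟩
    have hsplit : #{G ∈ R | G.NearlySparse M} + #{G ∈ R | ¬ G.NearlySparse M} = #R :=
      card_filter_add_card_filter_not _
    have hbad := card_not_nearlySparse_le (M := M) hd hn
    rw [regularProb, hRc, le_div_iff₀ hR0, sub_mul, one_mul]
    have h1 : (#{G ∈ R | G.NearlySparse M} : ℝ) + #{G ∈ R | ¬ G.NearlySparse M} = #R := by
      exact_mod_cast hsplit
    have h2 : (#{G ∈ R | G.NearlySparse M} : ℝ) ≤
        ({G ∈ regularGraphs n d | P n G}.ncard : ℝ) := by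
      exact_mod_cast hgood
    linarith
  · refine Eventually.of_forall fun n => div_le_one_of_le₀ ?_ (Nat.cast_nonneg _)
    exact_mod_cast Set.ncard_le_ncard (Set.sep_subset _ _) (Set.toFinite _)

lemma ne_bot_of_mem_regularGraphs {n d : ℕ} (hd : 0 < d) (hn : 0 < n)
    {G : SimpleGraph (Fin n)} (hG : G ∈ regularGraphs n d) : G ≠ ⊥ := by
  rintro rfl
  have := mem_regularGraphs.mp hG ⟨0, hn⟩
  simp at this
  omega

lemma regularWHP_vectorColoring {d : ℕ} (hd : 2 ≤ d) {κ : ℝ}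
    (hκ : κ > 2 + (d : ℝ) / (2 * Real.sqrt ((d : ℝ) - 1)))
    {P : ∀ n : ℕ, SimpleGraph (Fin n) → Prop}
    (hP : ∀ n (G : SimpleGraph (Fin n)), G ≠ ⊥ → ∀ Q : Fin n → Fin n → ℝ,
      (∀ i j, Q i j = Q j i) → (∀ i, Q i i = 1) →
      (∀ x : Fin n → ℝ, 0 ≤ ∑ i, ∑ j, Q i j * (x i * x j)) →
      (∀ i j, G.Adj i j → Q i j = -(1 / (κ - 1))) → P n G) : RegularWHP d P := by
  obtain ⟨M, hM⟩ := SimpleGraph.exists_vectorColoring_of_nearlySparse hd hκ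
  refine regularWHP_of_nearlySparse (M := M) (by omega) fun n hn G hG hs => ?_
  obtain ⟨Q, h1, h2, h3, h4⟩ := hM G (fun v => (SimpleGraph.IsRegularOfDegree.degree_eq hG v).le) hs
  exact hP n G (ne_bot_of_mem_regularGraphs (by omega) hn hG) Q h1 h2 h3 h4

end UnionBound

end

theorem theorem2 (d k : ℕ) (hd : 2 ≤ d) :
    (∀ τ : ℝ, τ < 1 →
      ((k : ℝ) - τ) / (1 - τ) > 2 + (d : ℝ) / (2 * Real.sqrt ((d : ℝ) - 1)) →
      RegularWHP d (fun _ G => ¬ HasSOSRefutation 2 (goodPartitionSystem G k τ))) ∧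
    ((k : ℝ) > 2 + (d : ℝ) / (2 * Real.sqrt ((d : ℝ) - 1)) →
      RegularWHP d (fun _ G => ¬ HasSOSRefutation 2 (coloringSystem G k))) := by
  have hfrac : 0 ≤ (d : ℝ) / (2 * Real.sqrt ((d : ℝ) - 1)) := by positivity
  constructor
  · intro τ hτ hk
    have hτ' : 0 < 1 - τ := by linarith
    -- The quotient exceeds 2, so k > 2 - τ > 1.
    have hk2 : 2 ≤ k := by
      have h1 : 2 < ((k : ℝ) - τ) / (1 - τ) := by linarith
      rw [lt_div_iff₀ hτ'] at h1
      have h2 : (1 : ℝ) < k := by linarith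
      exact_mod_cast h2
    have hk1 : (0 : ℝ) < k - 1 := by
      have : (2 : ℝ) ≤ k := by exact_mod_cast hk2
      linarith
    refine regularWHP_vectorColoring hd hk fun n G hG Q h1 h2 h3 h4 =>
      not_hasSOSRefutation_goodPartitionSystem G hk2 h1 h2 h3 (fun i j hij => ?_) hG
    rw [h4 i j hij]
    -- With κ = (k - τ)/(1 - τ), the edge correlation is -(1 - τ)/(k - 1), as the cut constraint
    -- requires.
    have : ((k : ℝ) - τ) / (1 - τ) - 1 = (k - 1) / (1 - τ) := by
      field_simp
      ring
    rw [this]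
    field_simp
    ring
  · intro hk
    have hk2 : 2 ≤ k := by
      have h2 : (2 : ℝ) < k := by linarith
      exact_mod_cast h2.le
    have hk1 : (0 : ℝ) < k - 1 := by
      have : (2 : ℝ) ≤ k := by exact_mod_cast hk2
      linarith
    refine regularWHP_vectorColoring hd hk fun n G _ Q h1 h2 h3 h4 =>
      not_hasSOSRefutation_coloringSystem G hk2 h1 h2 h3 fun i j hij => ?_
    rw [h4 i j hij]
    field_simp
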